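/- Let $X$ and $Y$ be Banach spaces over the same scalar field $\mathbb K$ ($\mathbb K=\mathbb R$ or $\mathbb C$), let $k\ge 1$, and let $P:X\to Y$ be a continuous $k$-homogeneous polynomial, i.e. $P(x)=A(x,\dots,x)$ for some continuous $k$-linear map $A:X^k\to Y$. Terminology. A series $\sum x_n$ in a Banach space $X$ is weakly unconditionally Cauchy (w.u.C.) if $\sum_n|\phi(x_n)|<\infty$ for every $\phi\in X^*$, and unconditionally convergent (u.c.) if every subseries converges. A continuous homogeneous polynomial $Q:Z\to Y$ between Banach spaces (in particular, a bounded linear operator) is unconditionally converging if for every w.u.C. series $\sum z_n$ in $Z$ the sequence $\bigl(Q(\sum_{i=1}^n z_i)\bigr)_n$ converges in norm; it is compact if it maps the closed unit ball to a relatively compact set. A sequence $(x_n)\subset X$ is equivalent to the $c_0$-basis if there are constants $c,C>0$ with $c\max_i|a_i|\le\|\sum_{i=1}^n a_ix_i\|\le C\max_i|a_i|$ for all $n$ and all scalars $a_1,\dots,a_n$. Subspaces are closed, and $j_M:M\to X$ denotes the inclusion of a subspace $M$. Operators are bounded and linear, and $a(i)$ is the $i$-th coordinate of $a\in c_0$.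 The following assertions are equivalent: (A) For every w.u.C. series $\sum x_n$ in $X$: if the set $\{P(\sum_{i=1}^\infty a_n(i)x_i)\}_{n\in\mathbb N}$ is relatively weakly compact for every bounded sequence $(a_n)\subset c_0$, then $\sum x_n$ is u.c. (B) For every w.u.C. series $\sum x_n$ in $X$: if the set $\{P(\sum_{i=1}^\infty a_n(i)x_i)\}_{n\in\mathbb N}$ is relatively compact for every bounded sequence $(a_n)\subset c_0$, then $\sum x_n$ is u.c. (C) If a sequence $(x_n)\subset X$ is equivalent to the $c_0$-basis, then there is a bounded sequence $(a_n)\subset c_0$ such that the set $\{P(\sum_{i=1}^\infty a_n(i)x_i)\}_{n\in\mathbb N}$ is not relatively weakly compact. (D) If a sequence $(x_n)\subset X$ is equivalent to the $c_0$-basis, then there is a bounded sequence $(a_n)\subset c_0$ such that the set $\{P(\sum_{i=1}^\infty a_n(i)x_i)\}_{n\in\mathbb N}$ is not relatively compact. (E) For every Banach space $Z$ and every operator $T:Z\to X$, if $P\circ T$ is unconditionally converging, then $T$ is unconditionally converging. (F) For every operator $T:c_0\to X$, if $P\circ T$ is compact, then $T$ is compact. (G) For every subspace $M\subseteq X$ containing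 a subspace isomorphic to $c_0$, the polynomial $P\circ j_M$ is not unconditionally converging. (H) For every subspace $M\subseteq X$ isomorphic to $c_0$, the polynomial $P\circ j_M$ is not compact. -/

import Mathlib

open Filter Topology
open scoped ZeroAtInfty

universe u v w

namespace OrliczPettis

variable (𝕜 : Type) [RCLike 𝕜]
variable {X : Type u} [NormedAddCommGroup X] [NormedSpace 𝕜 X]
variable {Y : Type v} [NormedAddCommGroup Y] [NormedSpace 𝕜 Y]

/-- The Banach space `c₀` of null sequences of scalars with the supremum norm
(`ℕ` carries the discrete topology). -/
abbrev CZero : Type := C₀(ℕ, 𝕜)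

/-- `P : X → Y` is a continuous `k`-homogeneous polynomial: the restriction to the diagonal of a
continuous `k`-linear map. -/
def IsHomogeneousPolynomial (k : ℕ) (P : X → Y) : Prop :=
  ∃ A : ContinuousMultilinearMap 𝕜 (fun _ : Fin k => X) Y, ∀ x, P x = A (fun _ => x)

/-- The formal series `∑ xₙ` is weakly unconditionally Cauchy. -/
def IsWUC (x : ℕ → X) : Prop :=
  ∀ φ : StrongDual 𝕜 X, Summable fun n => ‖φ (x n)‖

/-- The series `∑ xₙ` is unconditionally convergent: every subseries converges. -/
def IsUC (x : ℕ → X) : Prop :=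
  ∀ σ : ℕ → ℕ, StrictMono σ →
    ∃ s : X, Tendsto (fun n => ∑ i ∈ Finset.range n, x (σ i)) atTop (𝓝 s)

/-- `f` (a homogeneous polynomial, or a linear operator) is unconditionally converging: it maps
the partial sums of every w.u.C. series to a convergent sequence. -/
def IsUnconditionallyConverging (f : X → Y) : Prop :=
  ∀ x : ℕ → X, IsWUC 𝕜 x →
    ∃ y : Y, Tendsto (fun n => f (∑ i ∈ Finset.range n, x i)) atTop (𝓝 y)

/-- Relative compactness in the norm topology. -/
def IsRelCompact (S : Set Y) : Prop :=
  IsCompact (closure S)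

/-- Relative compactness in the weak topology. -/
def IsRelWeaklyCompact (S : Set Y) : Prop :=
  IsCompact (closure (toWeakSpace 𝕜 Y '' S))

/-- A polynomial is compact if it maps the closed unit ball to a relatively compact set. -/
def IsCompactPolynomial (P : X → Y) : Prop :=
  IsRelCompact (P '' Metric.closedBall 0 1)

/-- The sequence `(xₙ)` is equivalent to the unit vector basis of `c₀`:
`c max |aᵢ| ≤ ‖∑ aᵢ xᵢ‖ ≤ C max |aᵢ|` for all finite families of scalars
(`Fin n → 𝕜` carries the maximum norm). -/
def IsEquivalentToCZeroBasis (x : ℕ → X) : Prop :=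
  ∃ c C : ℝ, 0 < c ∧ ∀ (n : ℕ) (a : Fin n → 𝕜),
    c * ‖a‖ ≤ ‖∑ i, a i • x i‖ ∧ ‖∑ i, a i • x i‖ ≤ C * ‖a‖

variable {𝕜} in
/-- The set `{P (∑ᵢ aₙ(i) xᵢ) : n ∈ ℕ}` for a sequence `(aₙ)` in `c₀`. It is used only when
`∑ xᵢ` is w.u.C. and `X` is complete; each of these series is then unconditionally convergent. -/
noncomputable def imageSet (P : X → Y) (x : ℕ → X) (a : ℕ → CZero 𝕜) : Set Y :=
  Set.range fun n => P (∑' i, a n i • x i)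

variable (X) in
/-- `X` is isomorphic (linearly homeomorphic) to `c₀`. -/
def IsIsomorphicToCZero : Prop :=
  Nonempty (X ≃L[𝕜] CZero 𝕜)

variable (X) in
/-- `X` contains a copy of `c₀`. -/
def ContainsCZero : Prop :=
  ∃ N : Submodule 𝕜 X, IsIsomorphicToCZero 𝕜 N

end OrliczPettis

open OrliczPettis

/-! Each assertion says, in its own way, that `P` is not compact on any copy of $c_0$ in $X$;
`IsCompactOnCZero` expresses the opposite. A w.u.C. series in $X$ is the same thing as an operator
$c_0\to X$, its `synthesis` operator. If the series is not unconditionally convergent, the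
Bessaga–Pełczyński argument (`IsWUC.exists_blocks`) yields disjoint block sums equivalent to the
$c_0$-basis, and the operator of the blocks factors through that of the series. Thus good behaviour
of `P` along a bad series passes to a copy of $c_0$.

It remains to see that "weakly compact", "unconditionally converging" and "compact" coincide for
homogeneous polynomials $Q$ on $c_0$.

Weakly compact implies unconditionally converging
(`MapsBoundedToRelWeaklyCompact.isUnconditionallyConverging`, on any domain): study $S\mapsto
Q(\sum_{i\in S}y_i)$ on finite sets $S$ and show that it is Cauchy at every point of the Cantor
space of subsets of ℕ. Induct on the degree. Differences of $Q$ have smaller degree, so small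
oscillation at a single finite set spreads to every point. Weak compactness extends the function to
a weakly continuous one with norm-separable range, and Baire's theorem gives such a set.

Unconditionally converging implies compact (`IsUnconditionallyConverging.mapsBoundedToRelCompact`):
a gliding hump makes a subsequence of any bounded sequence in $c_0$ asymptotic to the partial sums
of a w.u.C. series, and $Q$ is Lipschitz on bounded sets. -/

namespace OrliczPettis

/-! ### Polynomial maps through iterated differences -/

/-- Polynomial maps of degree at most `k` between additive groups, defined by iterated
differences. -/
def IsPolyMap {X : Type*} {Y : Type*} [AddCommGroup X] [AddCommGroup Y] :
    ℕ → (X → Y) → Prop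
  | 0, f => ∀ x y, f x = f y
  | k + 1, f => ∀ h, IsPolyMap k fun x => f (x + h) - f x

section PolyMap

variable {X Y Z : Type*} [AddCommGroup X] [AddCommGroup Y] [AddCommGroup Z]

theorem IsPolyMap.zero (k : ℕ) : IsPolyMap k (fun _ : X => (0 : Y)) := by
  induction k with
  | zero => intro x y; rfl
  | succ k ih => intro h; simpa using ih

theorem IsPolyMap.add {k : ℕ} {f g : X → Y} (hf : IsPolyMap k f) (hg : IsPolyMap k g) :
    IsPolyMap k fun x => f x + g x := by
  induction k generalizing f g with
  | zero => intro x y; simp only [hf x y, hg x y]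
  | succ k ih =>
    intro h
    have h1 := ih (hf h) (hg h)
    simp only [sub_add_sub_comm] at h1
    exact h1

theorem IsPolyMap.sum {ι : Type*} {k : ℕ} {f : ι → X → Y} (s : Finset ι)
    (hf : ∀ i ∈ s, IsPolyMap k (f i)) : IsPolyMap k fun x => ∑ i ∈ s, f i x := by
  classical
  induction s using Finset.induction_on with
  | empty => simpa using IsPolyMap.zero k
  | insert i s hi ih =>
    simp only [Finset.sum_insert hi]
    exact (hf i (by simp)).add (ih fun j hj => hf j (by simp [hj]))

theorem IsPolyMap.map {k : ℕ} {f : X → Y} (hf : IsPolyMap k f) (g : Y →+ Z) :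
    IsPolyMap k fun x => g (f x) := by
  induction k generalizing f with
  | zero => intro x y; simp only [hf x y]
  | succ k ih => intro h; simpa using ih (hf h)

/-- Allowing frozen arguments outside `s` makes the induction close: the difference in direction `h`
expands over subsets of `s`, the full subset cancels, and each remaining term has fewer free slots.
-/
theorem isPolyMap_piecewise {R ι : Type*} [Semiring R] [Fintype ι] [DecidableEq ι]
    [Module R X] [Module R Y] (A : MultilinearMap R (fun _ : ι => X) Y) (k : ℕ) (s : Finset ι)
    (hs : s.card ≤ k) (v : ι → X) : IsPolyMap k fun x => A (s.piecewise (fun _ => x) v) := by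
  induction k generalizing s v with
  | zero =>
    obtain rfl : s = ∅ := by simpa using hs
    intro x y
    simp
  | succ k ih =>
    intro h
    have key : ∀ x : X, A (s.piecewise (fun _ => x + h) v) - A (s.piecewise (fun _ => x) v) =
        ∑ t ∈ s.ssubsets, A (t.piecewise (fun _ => x) (s.piecewise (fun _ => h) v)) := by
      intro x
      have h1 := A.map_piecewise_add (fun _ => x) (s.piecewise (fun _ => h) v) s
      have h2 : s.piecewise ((fun _ => x) + s.piecewise (fun _ => h) v)
          (s.piecewise (fun _ => h) v) = s.piecewise (fun _ => x + h) v := by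
        ext i
        by_cases hi : i ∈ s <;> simp [hi]
      rw [h2] at h1
      have h3 : s.piecewise (fun _ => x) (s.piecewise (fun _ => h) v) =
          s.piecewise (fun _ => x) v := by
        ext i
        by_cases hi : i ∈ s <;> simp [hi]
      rw [h1, Finset.ssubsets, ← Finset.sum_erase_add _ _ (Finset.mem_powerset_self s), h3,
        add_sub_cancel_right]
    simp only [key]
    refine IsPolyMap.sum _ fun t ht => ih t ?_ _
    have := Finset.card_lt_card (Finset.mem_ssubsets.1 ht)
    omega

theorem IsHomogeneousPolynomial.isPolyMap {𝕜 : Type} [RCLike 𝕜] {X : Type*} {Y : Type*}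
    [NormedAddCommGroup X] [NormedSpace 𝕜 X] [NormedAddCommGroup Y] [NormedSpace 𝕜 Y] {k : ℕ}
    {P : X → Y} (hP : IsHomogeneousPolynomial 𝕜 k P) : IsPolyMap k P := by
  obtain ⟨A, hA⟩ := hP
  have := isPolyMap_piecewise A.toMultilinearMap k Finset.univ (by simp) 0
  simpa [← hA] using this

end PolyMap

/-! ### Oscillation on the Cantor space; the scalar case -/

section TailCauchy

variable {X Y : Type*} [AddCommGroup X] [NormedAddCommGroup Y]

/-- The function `S ↦ F (∑ i ∈ S, y i)` on finite subsets of `ℕ` is Cauchy at every point of the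
Cantor space of all subsets of `ℕ`. -/
def TailCauchy (F : X → Y) (y : ℕ → X) : Prop :=
  ∀ a : Set ℕ, ∀ ε > 0, ∃ N : ℕ, ∀ S S' : Finset ℕ, (∀ i < N, i ∈ S ↔ i ∈ a) →
    (∀ i < N, i ∈ S' ↔ i ∈ a) → ‖F (∑ i ∈ S, y i) - F (∑ i ∈ S', y i)‖ ≤ ε

/-- There are finite sets at which `S ↦ F (∑ i ∈ S, y i)` has arbitrarily small oscillation. -/
def HasSmallOscillation (F : X → Y) (y : ℕ → X) : Prop :=
  ∀ ε > 0, ∃ (T : Finset ℕ) (N : ℕ), ∀ S : Finset ℕ, (∀ i ∈ S, N ≤ i) →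
    ‖F (∑ i ∈ S, y i + ∑ i ∈ T, y i) - F (∑ i ∈ T, y i)‖ ≤ ε

theorem TailCauchy.exists_forall_norm_sub_zero_le {F : X → Y} {y : ℕ → X} (hF : TailCauchy F y)
    {ε : ℝ} (hε : 0 < ε) :
    ∃ N : ℕ, ∀ S : Finset ℕ, (∀ i ∈ S, N ≤ i) → ‖F (∑ i ∈ S, y i) - F 0‖ ≤ ε := by
  obtain ⟨N, hN⟩ := hF ∅ ε hε
  refine ⟨N, fun S hS => ?_⟩
  have := hN S ∅ (fun i hi => by
    simp only [Set.mem_empty_iff_false, iff_false]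
    exact fun h => absurd (hS i h) (by omega)) (by simp)
  simpa using this

/-- Write $D_t(x)=F(x+t)-F(x)$. Since $F(r)-F(0)=(F(r+t)-F(t))-(D_t(r)-D_t(0))$, small oscillation
at one finite set moves to the empty set. From there it moves to any `a`, by splitting off the part
of `a` below a cutoff as a new translation. -/
theorem TailCauchy.of_differences {F : X → Y} {y : ℕ → X}
    (hG : ∀ h, TailCauchy (fun x => F (x + h) - F x) y) (hF : HasSmallOscillation F y) :
    TailCauchy F y := by
  have step : ∀ ε > 0, ∃ N : ℕ, ∀ S : Finset ℕ, (∀ i ∈ S, N ≤ i) →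
      ‖F (∑ i ∈ S, y i) - F 0‖ ≤ ε := by
    intro ε hε
    obtain ⟨T, N, hT⟩ := hF (ε / 2) (half_pos hε)
    obtain ⟨N', hN'⟩ := (hG (∑ i ∈ T, y i)).exists_forall_norm_sub_zero_le (half_pos hε)
    refine ⟨max N N', fun S hS => ?_⟩
    have h1 := hT S fun i hi => (le_max_left _ _).trans (hS i hi)
    have h2 := hN' S fun i hi => (le_max_right _ _).trans (hS i hi)
    rw [zero_add] at h2
    calc ‖F (∑ i ∈ S, y i) - F 0‖ = ‖(F (∑ i ∈ S, y i + ∑ i ∈ T, y i) - F (∑ i ∈ T, y i)) -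
          (F (∑ i ∈ S, y i + ∑ i ∈ T, y i) - F (∑ i ∈ S, y i) - (F (∑ i ∈ T, y i) - F 0))‖ := by
          congr 1; abel
      _ ≤ ε / 2 + ε / 2 := (norm_sub_le _ _).trans (add_le_add h1 h2)
      _ = ε := add_halves ε
  intro a ε hε
  classical
  have hε3 : 0 < ε / 3 := by positivity
  obtain ⟨n, hn⟩ := step (ε / 3) hε3
  set T : Finset ℕ := (Finset.range n).filter (· ∈ a) with hT
  obtain ⟨N, hN⟩ := hG (∑ i ∈ T, y i) (a \ {i | i < n}) (ε / 3) hε3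
  refine ⟨max n N, fun S S' hS hS' => ?_⟩
  have split : ∀ S : Finset ℕ, (∀ i < max n N, i ∈ S ↔ i ∈ a) →
      ∑ i ∈ S, y i = ∑ i ∈ S.filter (n ≤ ·), y i + ∑ i ∈ T, y i := by
    intro S hS
    rw [← Finset.sum_filter_add_sum_filter_not S (n ≤ ·)]
    congr 2
    ext i
    simp only [Finset.mem_filter, hT, Finset.mem_range, not_le]
    constructor
    · rintro ⟨h1, h2⟩
      exact ⟨h2, (hS i (lt_max_of_lt_left h2)).1 h1⟩
    · rintro ⟨h1, h2⟩
      exact ⟨(hS i (lt_max_of_lt_left h1)).2 h2, h1⟩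
  have agree : ∀ S : Finset ℕ, (∀ i < max n N, i ∈ S ↔ i ∈ a) →
      ∀ i < N, i ∈ S.filter (n ≤ ·) ↔ i ∈ a \ {i | i < n} := by
    intro S hS i hi
    simp [hS i (lt_max_of_lt_right hi)]
  have h0 := hN _ _ (agree S hS) (agree S' hS')
  have h1 := hn (S.filter (n ≤ ·)) (by simp)
  have h2 := hn (S'.filter (n ≤ ·)) (by simp)
  rw [split S hS, split S' hS']
  set r := ∑ i ∈ S.filter (n ≤ ·), y i
  set r' := ∑ i ∈ S'.filter (n ≤ ·), y i
  set t := ∑ i ∈ T, y i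
  calc ‖F (r + t) - F (r' + t)‖ =
        ‖(F (r + t) - F r - (F (r' + t) - F r')) + ((F r - F 0) - (F r' - F 0))‖ := by
        congr 1; abel
    _ ≤ ε / 3 + (ε / 3 + ε / 3) :=
        (norm_add_le _ _).trans (add_le_add h0 ((norm_sub_le _ _).trans (add_le_add h1 h2)))
    _ = ε := by ring

theorem TailCauchy.of_const {F : X → Y} {y : ℕ → X} (hF : ∀ x x', F x = F x') :
    TailCauchy F y := by
  intro a ε hε
  refine ⟨0, fun S S' _ _ => ?_⟩
  rw [hF _ (∑ i ∈ S', y i), sub_self, norm_zero]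
  exact hε.le

/-- A function which is asymptotically additive along disjoint blocks and takes uniformly positive
increments on blocks arbitrarily far out is unbounded. -/
theorem not_bddAbove_of_frequently_increment {F : X → ℝ} {y : ℕ → X}
    (hG : ∀ h, TailCauchy (fun x => F (x + h) - F x) y) {ε : ℝ} (hε : 0 < ε)
    (hF : ∀ N : ℕ, ∃ S : Finset ℕ, (∀ i ∈ S, N ≤ i) ∧ ε ≤ F (∑ i ∈ S, y i) - F 0) :
    ¬ BddAbove (Set.range fun S : Finset ℕ => F (∑ i ∈ S, y i)) := by
  classical
  have key : ∀ m : ℕ, ∃ T : Finset ℕ, F 0 + m * (ε / 2) ≤ F (∑ i ∈ T, y i) := by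
    intro m
    induction m with
    | zero => exact ⟨∅, by simp⟩
    | succ m ih =>
      obtain ⟨T, hT⟩ := ih
      obtain ⟨N, hN⟩ := (hG (∑ i ∈ T, y i)).exists_forall_norm_sub_zero_le (half_pos hε)
      -- The second bound puts `S` beyond `T`, so the sums over `S` and `T` add up. The increment
      -- over `T` is then the one over the empty set up to ε/2.
      obtain ⟨S, hS, hSε⟩ := hF (max N (T.sup id + 1))
      have hdisj : Disjoint S T := by
        rw [Finset.disjoint_left]
        intro i hi hi'
        have h1 := (le_max_right _ _).trans (hS i hi)
        have h2 : id i ≤ T.sup id := Finset.le_sup hi'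
        simp only [id] at h2
        omega
      refine ⟨S ∪ T, ?_⟩
      rw [Finset.sum_union hdisj]
      have h1 := hN S fun i hi => (le_max_left _ _).trans (hS i hi)
      rw [zero_add, Real.norm_eq_abs, abs_le] at h1
      push_cast
      linarith [h1.1]
  rintro ⟨M, hM⟩
  obtain ⟨m, hm⟩ := exists_nat_gt ((M - F 0) / (ε / 2))
  obtain ⟨T, hT⟩ := key m
  rw [div_lt_iff₀ (half_pos hε)] at hm
  have := hM ⟨T, rfl⟩
  simp only at this
  linarith

/-- For real values boundedness suffices: increments of one sign, bounded below and arbitrarily far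
out, would accumulate. This is applied to `F` and to `-F`. Boundedness is assumed for all translates
so that differences inherit it. -/
theorem IsPolyMap.tailCauchy_of_bounded {k : ℕ} {F : X → ℝ} {y : ℕ → X} (hF : IsPolyMap k F)
    (hb : ∀ h, Bornology.IsBounded (Set.range fun S : Finset ℕ => F (h + ∑ i ∈ S, y i))) :
    TailCauchy F y := by
  induction k generalizing F with
  | zero => exact TailCauchy.of_const hF
  | succ k ih =>
    have hG : ∀ h, TailCauchy (fun x => F (x + h) - F x) y := by
      intro h
      refine ih (hF h) fun h' => ?_
      obtain ⟨C, hC⟩ := isBounded_iff_forall_norm_le.1 (hb (h' + h))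
      obtain ⟨C', hC'⟩ := isBounded_iff_forall_norm_le.1 (hb h')
      refine isBounded_iff_forall_norm_le.2 ⟨C + C', ?_⟩
      rintro _ ⟨S, rfl⟩
      have h1 := hC _ ⟨S, rfl⟩
      have h2 := hC' _ ⟨S, rfl⟩
      simp only [add_right_comm h' h] at h1
      exact (norm_sub_le _ _).trans (add_le_add h1 h2)
    have hG' : ∀ h, TailCauchy (fun x => -F (x + h) - -F x) y := by
      intro h a ε hε
      obtain ⟨N, hN⟩ := hG h a ε hε
      refine ⟨N, fun S S' hS hS' => ?_⟩
      have := hN S S' hS hS'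
      simp only [Real.norm_eq_abs, abs_le] at this ⊢
      constructor <;> linarith [this.1, this.2]
    refine TailCauchy.of_differences hG fun ε hε => ?_
    have hb0 := hb 0
    simp only [zero_add] at hb0
    have h1 := mt (not_bddAbove_of_frequently_increment hG hε) (not_not.2 hb0.bddAbove)
    have h2 := mt (not_bddAbove_of_frequently_increment (F := fun x => -F x) hG' hε)
      (not_not.2 (by
        obtain ⟨C, hC⟩ := isBounded_iff_forall_norm_le.1 hb0
        refine ⟨C, ?_⟩
        rintro _ ⟨S, rfl⟩
        have := hC _ ⟨S, rfl⟩
        rw [Real.norm_eq_abs] at this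
        exact (neg_le_abs _).trans this))
    push Not at h1 h2
    obtain ⟨N, hN⟩ := h1
    obtain ⟨N', hN'⟩ := h2
    refine ⟨∅, max N N', fun S hS => ?_⟩
    have h3 := hN S fun i hi => (le_max_left _ _).trans (hS i hi)
    have h4 := hN' S fun i hi => (le_max_right _ _).trans (hS i hi)
    rw [Finset.sum_empty, add_zero, Real.norm_eq_abs, abs_le]
    constructor <;> linarith

end TailCauchy

/-! ### From weak to norm continuity by Baire category -/

section WeakCompactness

variable {𝕜 : Type} [RCLike 𝕜] {X Y : Type*} [AddCommGroup X] [NormedAddCommGroup Y]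
  [NormedSpace 𝕜 Y]

theorem IsRelCompact.isRelWeaklyCompact {S : Set Y} (hS : IsRelCompact S) :
    IsRelWeaklyCompact 𝕜 S := by
  have h : IsCompact (toWeakSpace 𝕜 Y '' closure S) :=
    IsCompact.image hS (toWeakSpaceCLM 𝕜 Y).continuous
  exact h.closure_of_subset (Set.image_mono subset_closure)

/-- Ultrafilter limits exist weakly for functions with relatively weakly compact range. -/
theorem IsRelWeaklyCompact.exists_forall_tendsto {ι : Type*} {f : ι → Y}
    (hf : IsRelWeaklyCompact 𝕜 (Set.range f)) (U : Ultrafilter ι) :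
    ∃ y : Y, ∀ φ : StrongDual 𝕜 Y, Tendsto (fun i => φ (f i)) U (𝓝 (φ y)) := by
  obtain ⟨y, -, hy⟩ := isCompact_iff_ultrafilter_le_nhds'.1 hf
    (U.map fun i => toWeakSpace 𝕜 Y (f i))
    (Filter.mem_map.2 (Filter.univ_mem' fun i =>
      subset_closure (Set.mem_image_of_mem _ (Set.mem_range_self i))))
  refine ⟨(toWeakSpace 𝕜 Y).symm y, fun φ => ?_⟩
  have h : Continuous fun z : WeakSpace 𝕜 Y => φ ((toWeakSpace 𝕜 Y).symm z) :=
    WeakBilin.eval_continuous (topDualPairing 𝕜 Y).flip φ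
  exact (h.tendsto y).comp hy

variable (𝕜) in
theorem norm_le_of_forall_re_le {z : Y} {ε : ℝ} (hε : 0 ≤ ε)
    (h : ∀ φ : StrongDual 𝕜 Y, ‖φ‖ ≤ 1 → RCLike.re (φ z) ≤ ε) : ‖z‖ ≤ ε := by
  by_cases hz : z = 0
  · simpa [hz] using hε
  · obtain ⟨φ, h1, h2⟩ := exists_dual_vector 𝕜 z (by simpa using hz)
    have := h φ h1.le
    simpa [h2] using this

variable (𝕜) in
theorem eq_of_forall_re_eq {z z' : Y}
    (h : ∀ φ : StrongDual 𝕜 Y, RCLike.re (φ z) = RCLike.re (φ z')) : z = z' := by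
  rw [← sub_eq_zero, ← norm_le_zero_iff]
  refine norm_le_of_forall_re_le 𝕜 le_rfl fun φ _ => ?_
  simp [h φ]

/-- The real part of a functional as an additive map. -/
def reDual (φ : StrongDual 𝕜 Y) : Y →+ ℝ := (RCLike.re : 𝕜 →+ ℝ).comp φ.toLinearMap.toAddMonoidHom

-- Mazur's theorem for subspaces, by Hahn–Banach separation. It confines weak limits to a
-- norm-separable set.
variable (𝕜) in
theorem mem_closure_span_of_tendsto {s : Set Y} {ι : Type*} {l : Filter ι} [l.NeBot] {f : ι → Y}
    (hf : ∀ i, f i ∈ s) {z : Y}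
    (h : ∀ φ : StrongDual 𝕜 Y, Tendsto (fun i => RCLike.re (φ (f i))) l (𝓝 (RCLike.re (φ z)))) :
    z ∈ closure (Submodule.span 𝕜 s : Set Y) := by
  let _ : NormedSpace ℝ Y := NormedSpace.restrictScalars ℝ 𝕜 Y
  let _ : IsScalarTower ℝ 𝕜 Y :=
    IsScalarTower.of_algebraMap_smul fun _ _ => rfl
  by_contra hz
  have hconv : Convex ℝ (closure (Submodule.span 𝕜 s : Set Y)) := by
    refine Convex.closure ?_
    exact ((Submodule.span 𝕜 s).restrictScalars ℝ).convex
  obtain ⟨φ, u, h1, h2⟩ := RCLike.geometric_hahn_banach_closed_point (𝕜 := 𝕜) hconv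
    isClosed_closure hz
  have h3 : RCLike.re (φ z) ≤ u := le_of_tendsto (h φ) (Eventually.of_forall fun i =>
    (h1 _ (subset_closure (Submodule.subset_span (hf i)))).le)
  linarith

/-- A function on the Cantor space which is weakly continuous on the finite sets, in the sense of
`TailCauchy`, and has weakly convergent ultrafilter limits has points of small norm oscillation. -/
theorem HasSmallOscillation.of_weak {F : X → Y} {y : ℕ → X}
    (hφ : ∀ φ : StrongDual 𝕜 Y, TailCauchy (fun x => RCLike.re (φ (F x))) y)
    (hU : ∀ U : Ultrafilter (Finset ℕ), ∃ z : Y, ∀ φ : StrongDual 𝕜 Y,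
      Tendsto (fun S => φ (F (∑ i ∈ S, y i))) U (𝓝 (φ z))) :
    HasSmallOscillation F y := by
  classical
  let tr : (ℕ → Bool) → ℕ → Finset ℕ := fun a n => (Finset.range n).filter (a · = true)
  have htr : ∀ a n m, n ≤ m → ∀ i < n, i ∈ tr a m ↔ i ∈ {i | a i = true} := by
    intro a n m hnm i hi
    simp [tr, hi.trans_le hnm]
  have hex : ∀ a : ℕ → Bool, ∃ z : Y, ∀ φ : StrongDual 𝕜 Y,
      Tendsto (fun n => RCLike.re (φ (F (∑ i ∈ tr a n, y i)))) atTop (𝓝 (RCLike.re (φ z))) := by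
    intro a
    obtain ⟨z, hz⟩ := hU ((hyperfilter ℕ).map (tr a))
    refine ⟨z, fun φ => ?_⟩
    have h1 : Tendsto (fun n => RCLike.re (φ (F (∑ i ∈ tr a n, y i)))) (hyperfilter ℕ)
        (𝓝 (RCLike.re (φ z))) :=
      (RCLike.continuous_re.tendsto _).comp (tendsto_map'_iff.1 (hz φ))
    -- The ultrafilter only provides the candidate `z`, one for all functionals; the Cauchy property
    -- upgrades this to convergence along the whole sequence.
    have h2 : CauchySeq fun n => RCLike.re (φ (F (∑ i ∈ tr a n, y i))) := by
      rw [Metric.cauchySeq_iff]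
      intro ε hε
      obtain ⟨N, hN⟩ := hφ φ {i | a i = true} (ε / 2) (half_pos hε)
      refine ⟨N, fun m hm n hn => ?_⟩
      rw [dist_eq_norm]
      exact (hN _ _ (htr a N m hm) (htr a N n hn)).trans_lt (half_lt_self hε)
    obtain ⟨r, hr⟩ := cauchySeq_tendsto_of_complete h2
    have h3 := hr.mono_left (Nat.hyperfilter_le_atTop)
    rwa [tendsto_nhds_unique h1 h3]
  choose f hf using hex
  have happrox : ∀ (φ : StrongDual 𝕜 Y) (a : ℕ → Bool), ∀ ε > 0, ∃ N, ∀ b : ℕ → Bool,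
      (∀ i < N, b i = a i) → |RCLike.re (φ (f b)) - RCLike.re (φ (f a))| ≤ ε := by
    intro φ a ε hε
    obtain ⟨N, hN⟩ := hφ φ {i | a i = true} ε hε
    refine ⟨N, fun b hb => ?_⟩
    refine le_of_tendsto ((hf b φ).sub (hf a φ)).abs
      (eventually_atTop.2 ⟨N, fun n hn => ?_⟩)
    refine hN _ _ (fun i hi => ?_) (htr a N n hn)
    rw [htr b N n hn i hi, Set.mem_ofPred_eq, Set.mem_ofPred_eq, hb i hi]
  have hcont : ∀ φ : StrongDual 𝕜 Y, Continuous fun a => RCLike.re (φ (f a)) := by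
    intro φ
    rw [continuous_iff_continuousAt]
    intro a
    rw [ContinuousAt, Metric.tendsto_nhds]
    intro ε hε
    obtain ⟨N, hN⟩ := happrox φ a (ε / 2) (half_pos hε)
    have hopen : ∀ᶠ b in 𝓝 a, ∀ i ∈ Set.Iio N, b i = a i := by
      rw [Filter.eventually_all_finite (Set.finite_Iio N)]
      intro i _
      have h1 : IsOpen ((fun b : ℕ → Bool => b i) ⁻¹' {a i}) :=
        (isOpen_discrete {a i}).preimage (continuous_apply i)
      exact h1.mem_nhds rfl
    filter_upwards [hopen] with b hb
    rw [Real.dist_eq]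
    exact (hN b hb).trans_lt (half_lt_self hε)
  have hfin : ∀ S : Finset ℕ, f (fun i => decide (i ∈ S)) = F (∑ i ∈ S, y i) := by
    intro S
    refine eq_of_forall_re_eq 𝕜 fun φ => ?_
    refine tendsto_nhds_unique (hf _ φ) (tendsto_const_nhds.congr' ?_)
    filter_upwards [eventually_ge_atTop (S.sup id + 1)] with n hn
    have : tr (fun i => decide (i ∈ S)) n = S := by
      ext i
      simp only [tr, decide_eq_true_eq, Finset.mem_filter, Finset.mem_range,
        and_iff_right_iff_imp]
      intro hi
      have h2 : id i ≤ S.sup id := Finset.le_sup hi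
      simp only [id] at h2
      omega
    rw [this]
  have hsep : TopologicalSpace.IsSeparable
      (closure (Submodule.span 𝕜 (Set.range fun S : Finset ℕ => F (∑ i ∈ S, y i)) : Set Y)) :=
    ((Set.countable_range _).isSeparable.span).closure
  obtain ⟨c, hc, hc'⟩ := hsep
  intro ε hε
  have : Countable c := hc.to_subtype
  -- A norm ball is an intersection of half-spaces given by real parts of functionals, so weak
  -- continuity of `f` makes its preimage closed.
  have hclosed : ∀ z : c, IsClosed {a : ℕ → Bool | ‖f a - z‖ ≤ ε / 2} := by
    intro z
    have : {a : ℕ → Bool | ‖f a - z‖ ≤ ε / 2} = ⋂ (φ : StrongDual 𝕜 Y) (_ : ‖φ‖ ≤ 1),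
        {a | RCLike.re (φ (f a)) - RCLike.re (φ z) ≤ ε / 2} := by
      ext a
      simp only [Set.mem_iInter, Set.mem_ofPred_eq]
      constructor
      · intro h φ hφ1
        rw [← map_sub, ← map_sub]
        calc RCLike.re (φ (f a - z)) ≤ ‖φ (f a - z)‖ := RCLike.re_le_norm _
          _ ≤ ‖f a - z‖ := φ.le_of_opNorm_le_of_le hφ1 le_rfl |>.trans (by rw [one_mul])
          _ ≤ _ := h
      · intro h
        refine norm_le_of_forall_re_le 𝕜 (half_pos hε).le fun φ hφ1 => ?_
        rw [map_sub, map_sub]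
        exact h φ hφ1
    rw [this]
    exact isClosed_iInter fun φ => isClosed_iInter fun _ =>
      isClosed_le ((hcont φ).sub continuous_const) continuous_const
  have hcover : ⋃ z : c, {a : ℕ → Bool | ‖f a - z‖ ≤ ε / 2} = Set.univ := by
    refine Set.eq_univ_of_forall fun a => ?_
    have ha := hc' (mem_closure_span_of_tendsto 𝕜 (fun n => Set.mem_range_self (tr a n)) (hf a))
    obtain ⟨z, hz, hz'⟩ := Metric.mem_closure_iff.1 ha (ε / 2) (half_pos hε)
    rw [dist_eq_norm] at hz'
    exact Set.mem_iUnion.2 ⟨⟨z, hz⟩, hz'.le⟩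
  -- Baire: some preimage contains a cylinder around `a`, which depends on coordinates up to `N`
  -- only. Truncating `a` there gives the finite set sought.
  obtain ⟨z, a, ha⟩ := nonempty_interior_of_iUnion_of_closed hclosed hcover
  rw [mem_interior_iff_mem_nhds, nhds_pi, Filter.mem_pi] at ha
  obtain ⟨I, hI, t, ht, hsub⟩ := ha
  obtain ⟨N, hN⟩ := hI.bddAbove
  have hball : ∀ S : Finset ℕ, (∀ i ≤ N, i ∈ S ↔ a i = true) →
      ‖F (∑ i ∈ S, y i) - z‖ ≤ ε / 2 := by
    intro S hS
    rw [← hfin]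
    refine hsub fun i hi => ?_
    have : decide (i ∈ S) = a i := by
      rw [Bool.eq_iff_iff, decide_eq_true_iff]
      exact hS i (hN hi)
    simp only [this]
    exact mem_of_mem_nhds (ht i)
  refine ⟨tr a (N + 1), N + 1, fun S hS => ?_⟩
  have hd : Disjoint S (tr a (N + 1)) := by
    rw [Finset.disjoint_left]
    intro i hi hi'
    have := hS i hi
    simp only [tr, Finset.mem_filter, Finset.mem_range] at hi'
    omega
  rw [← Finset.sum_union hd]
  have hT : ∀ i ≤ N, i ∈ tr a (N + 1) ↔ a i = true := fun i hi =>
    htr a (N + 1) (N + 1) le_rfl i (by omega)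
  have h1 := hball (S ∪ tr a (N + 1)) fun i hi => by
    rw [Finset.mem_union, hT i hi, or_iff_right]
    intro h
    have := hS i h
    omega
  have h2 := hball _ hT
  calc _ = ‖(F (∑ i ∈ S ∪ tr a (N + 1), y i) - z) - (F (∑ i ∈ tr a (N + 1), y i) - z)‖ := by
        congr 1; abel
    _ ≤ ε / 2 + ε / 2 := (norm_sub_le _ _).trans (add_le_add h1 h2)
    _ = ε := add_halves ε

/-- Both hypotheses pass to differences because they range over all translates. Small oscillation
comes from Baire, with weak continuity supplied by the scalar case applied to the real parts of
functionals. -/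
theorem IsPolyMap.tailCauchy_of_weak {k : ℕ} {F : X → Y} {y : ℕ → X} (hF : IsPolyMap k F)
    (hb : ∀ h, Bornology.IsBounded (Set.range fun S : Finset ℕ => F (h + ∑ i ∈ S, y i)))
    (hU : ∀ (h : X) (U : Ultrafilter (Finset ℕ)), ∃ z : Y, ∀ φ : StrongDual 𝕜 Y,
      Tendsto (fun S => φ (F (h + ∑ i ∈ S, y i))) U (𝓝 (φ z))) :
    TailCauchy F y := by
  induction k generalizing F with
  | zero => exact TailCauchy.of_const hF
  | succ k ih =>
    refine TailCauchy.of_differences (fun h => ih (hF h) (fun h' => ?_) fun h' U => ?_)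
      (HasSmallOscillation.of_weak (𝕜 := 𝕜) (fun φ => ?_) fun U => ?_)
    · obtain ⟨C, hC⟩ := isBounded_iff_forall_norm_le.1 (hb (h' + h))
      obtain ⟨C', hC'⟩ := isBounded_iff_forall_norm_le.1 (hb h')
      refine isBounded_iff_forall_norm_le.2 ⟨C + C', ?_⟩
      rintro _ ⟨S, rfl⟩
      have h1 := hC _ ⟨S, rfl⟩
      have h2 := hC' _ ⟨S, rfl⟩
      simp only [add_right_comm h' h] at h1
      exact (norm_sub_le _ _).trans (add_le_add h1 h2)
    · obtain ⟨z, hz⟩ := hU (h' + h) U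
      obtain ⟨z', hz'⟩ := hU h' U
      refine ⟨z - z', fun φ => ?_⟩
      simpa only [map_sub, add_right_comm h' h] using (hz φ).sub (hz' φ)
    · refine (hF.map (reDual φ)).tailCauchy_of_bounded fun h => ?_
      obtain ⟨C, hC⟩ := isBounded_iff_forall_norm_le.1 (hb h)
      refine isBounded_iff_forall_norm_le.2 ⟨‖φ‖ * C, ?_⟩
      rintro _ ⟨S, rfl⟩
      exact (RCLike.norm_re_le_norm _).trans (φ.le_opNorm_of_le (hC _ ⟨S, rfl⟩))
    · simpa using hU 0 U

end WeakCompactness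

/-! ### Weakly unconditionally Cauchy series -/

section WUC

variable {𝕜 : Type} [RCLike 𝕜] {X Z : Type*} [NormedAddCommGroup X] [NormedSpace 𝕜 X]
  [NormedAddCommGroup Z] [NormedSpace 𝕜 Z]

theorem IsWUC.map {x : ℕ → X} (hx : IsWUC 𝕜 x) (T : X →L[𝕜] Z) : IsWUC 𝕜 fun n => T (x n) :=
  fun φ => hx (φ.comp T)

theorem IsWUC.comp_injective {x : ℕ → X} (hx : IsWUC 𝕜 x) {f : ℕ → ℕ}
    (hf : Function.Injective f) : IsWUC 𝕜 fun n => x (f n) :=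
  fun φ => (hx φ).comp_injective hf

/-- Uniform boundedness on the dual: each functional φ bounds all these sums by
$\sum|\varphi(x_i)|$. No completeness of $X$ is needed, the dual being complete. -/
theorem IsWUC.exists_forall_norm_sum_le {x : ℕ → X} (hx : IsWUC 𝕜 x) :
    ∃ M : ℝ, 0 ≤ M ∧ ∀ (S : Finset ℕ) (a : ℕ → 𝕜) (r : ℝ), 0 ≤ r → (∀ i ∈ S, ‖a i‖ ≤ r) →
      ‖∑ i ∈ S, a i • x i‖ ≤ M * r := by
  let ι := {p : Finset ℕ × (ℕ → 𝕜) // ∀ i ∈ p.1, ‖p.2 i‖ ≤ 1}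
  obtain ⟨M, hM⟩ := banach_steinhaus (𝕜 := 𝕜) (𝕜₂ := 𝕜) (E := StrongDual 𝕜 X) (F := 𝕜)
    (g := fun p : ι => NormedSpace.inclusionInDoubleDual 𝕜 X (∑ i ∈ p.1.1, p.1.2 i • x i))
    (fun φ => ⟨∑' i, ‖φ (x i)‖, fun p => by
      rw [NormedSpace.dual_def, map_sum]
      refine (norm_sum_le _ _).trans (le_trans (Finset.sum_le_sum fun i hi => ?_)
        ((hx φ).sum_le_tsum p.1.1 fun i _ => norm_nonneg _))
      rw [map_smul, norm_smul]
      exact mul_le_of_le_one_left (norm_nonneg _) (p.2 i hi)⟩)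
  have hM' : ∀ (S : Finset ℕ) (a : ℕ → 𝕜), (∀ i ∈ S, ‖a i‖ ≤ 1) → ‖∑ i ∈ S, a i • x i‖ ≤ M := by
    intro S a ha
    have := hM ⟨(S, a), ha⟩
    rwa [← (NormedSpace.inclusionInDoubleDualLi 𝕜).norm_map (∑ i ∈ S, a i • x i)]
  refine ⟨M, (norm_nonneg _).trans (hM' ∅ 0 (by simp)), fun S a r hr ha => ?_⟩
  rcases hr.eq_or_lt with rfl | hr
  · rw [Finset.sum_eq_zero, norm_zero, mul_zero]
    intro i hi
    rw [norm_le_zero_iff.1 (ha i hi), zero_smul]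
  · have h := hM' S (fun i => ((r⁻¹ : ℝ) : 𝕜) * a i) fun i hi => by
      rw [norm_mul, RCLike.norm_ofReal, abs_of_pos (inv_pos.2 hr), inv_mul_le_iff₀ hr, mul_one]
      exact ha i hi
    simp only [mul_smul, ← Finset.smul_sum] at h
    rw [norm_smul, RCLike.norm_ofReal, abs_of_pos (inv_pos.2 hr), inv_mul_le_iff₀ hr] at h
    rwa [mul_comm]

theorem IsWUC.of_forall_norm_sum_range_le {x : ℕ → X} {M : ℝ}
    (h : ∀ (n : ℕ) (a : ℕ → 𝕜), (∀ i, ‖a i‖ ≤ 1) → ‖∑ i ∈ Finset.range n, a i • x i‖ ≤ M) :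
    IsWUC 𝕜 x := by
  intro φ
  choose a ha ha' using fun i => RCLike.exists_norm_eq_mul_self (φ (x i))
  refine summable_of_sum_range_le (c := ‖φ‖ * M) (fun _ => norm_nonneg _) fun n => ?_
  have h1 : ((∑ i ∈ Finset.range n, ‖φ (x i)‖ : ℝ) : 𝕜) =
      φ (∑ i ∈ Finset.range n, a i • x i) := by
    rw [map_sum, RCLike.ofReal_sum]
    exact Finset.sum_congr rfl fun i _ => by rw [map_smul, smul_eq_mul, ha']
  calc ∑ i ∈ Finset.range n, ‖φ (x i)‖ = ‖((∑ i ∈ Finset.range n, ‖φ (x i)‖ : ℝ) : 𝕜)‖ := by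
        rw [RCLike.norm_ofReal, abs_of_nonneg (Finset.sum_nonneg fun _ _ => norm_nonneg _)]
    _ ≤ ‖φ‖ * M := by
        rw [h1]
        exact φ.le_opNorm_of_le (h n a fun i => (ha i).le)

theorem IsWUC.isBounded_range_sum {x : ℕ → X} (hx : IsWUC 𝕜 x) :
    Bornology.IsBounded (Set.range fun S : Finset ℕ => ∑ i ∈ S, x i) := by
  obtain ⟨M, -, hM⟩ := hx.exists_forall_norm_sum_le
  refine isBounded_iff_forall_norm_le.2 ⟨M * 1, ?_⟩
  rintro _ ⟨S, rfl⟩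
  simpa using hM S (fun _ => 1) 1 zero_le_one (by simp)

/-- Block sums over disjoint finite sets of a w.u.C. series form a w.u.C. series. -/
theorem IsWUC.blocks {x : ℕ → X} (hx : IsWUC 𝕜 x) {B : ℕ → Finset ℕ}
    (hB : Pairwise (Function.onFun Disjoint B)) : IsWUC 𝕜 fun m => ∑ i ∈ B m, x i := by
  intro φ
  refine summable_of_sum_range_le (c := ∑' i, ‖φ (x i)‖) (fun _ => norm_nonneg _) fun n => ?_
  calc ∑ m ∈ Finset.range n, ‖φ (∑ i ∈ B m, x i)‖
      ≤ ∑ m ∈ Finset.range n, ∑ i ∈ B m, ‖φ (x i)‖ := by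
        refine Finset.sum_le_sum fun m _ => ?_
        rw [map_sum]
        exact norm_sum_le _ _
    _ = ∑ i ∈ (Finset.range n).biUnion B, ‖φ (x i)‖ := by
        rw [Finset.sum_biUnion fun i _ j _ hij => hB hij]
    _ ≤ _ := (hx φ).sum_le_tsum _ fun _ _ => norm_nonneg _

theorem isUC_of_summable {x : ℕ → X} [CompleteSpace X] (hx : Summable x) : IsUC x :=
  fun _ hσ => ⟨_, (hx.comp_injective hσ.injective).hasSum.tendsto_sum_nat⟩

theorem IsUC.tendsto_zero {x : ℕ → X} (hx : IsUC x) : Tendsto x atTop (𝓝 0) := by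
  obtain ⟨s, hs⟩ := hx id strictMono_id
  have := ((tendsto_add_atTop_iff_nat 1).2 hs).sub hs
  simpa [Finset.sum_range_succ] using this

/-- The upper estimate is automatic for a w.u.C. series, so only the lower one, at a coordinate of
maximal modulus, has to be checked. -/
theorem IsEquivalentToCZeroBasis.of_isWUC {x : ℕ → X} (hx : IsWUC 𝕜 x) {c : ℝ} (hc : 0 < c)
    (h : ∀ (n : ℕ) (a : ℕ → 𝕜) (l : ℕ), l < n → (∀ i, ‖a i‖ ≤ ‖a l‖) →
      c * ‖a l‖ ≤ ‖∑ i ∈ Finset.range n, a i • x i‖) : IsEquivalentToCZeroBasis 𝕜 x := by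
  obtain ⟨M, hM0, hM⟩ := hx.exists_forall_norm_sum_le
  refine ⟨c, M, hc, fun n a => ?_⟩
  let b : ℕ → 𝕜 := fun i => if h : i < n then a ⟨i, h⟩ else 0
  have hb : ∀ i : Fin n, b i = a i := fun i => by simp [b]
  have hsum : ∑ i, a i • x i = ∑ i ∈ Finset.range n, b i • x i := by
    rw [← Fin.sum_univ_eq_sum_range fun i => b i • x i]
    exact Finset.sum_congr rfl fun i _ => by rw [hb]
  have hle : ∀ i, ‖b i‖ ≤ ‖a‖ := by
    intro i
    by_cases hi : i < n
    · simp only [b, hi, dif_pos]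
      exact norm_le_pi_norm a _
    · simp [b, hi]
  rw [hsum]
  refine ⟨?_, hM _ b _ (norm_nonneg _) fun i _ => hle i⟩
  rcases isEmpty_or_nonempty (Fin n) with hn | hn
  · rw [Subsingleton.elim a 0, norm_zero, mul_zero]
    exact norm_nonneg _
  · obtain ⟨l, hl⟩ := Finite.exists_max fun i => ‖a i‖
    have h1 : ‖a‖ = ‖b l‖ := by
      rw [hb]
      exact le_antisymm ((pi_norm_le_iff_of_nonneg (norm_nonneg _)).2 hl) (norm_le_pi_norm a l)
    rw [h1] at hle ⊢
    exact h n b l l.2 hle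

theorem IsEquivalentToCZeroBasis.exists_bounds {x : ℕ → X} (hx : IsEquivalentToCZeroBasis 𝕜 x) :
    ∃ c C : ℝ, 0 < c ∧ ∀ (n : ℕ) (a : ℕ → 𝕜),
      (∀ l < n, c * ‖a l‖ ≤ ‖∑ i ∈ Finset.range n, a i • x i‖) ∧
      ((∀ i, ‖a i‖ ≤ 1) → ‖∑ i ∈ Finset.range n, a i • x i‖ ≤ C) := by
  obtain ⟨c, C, hc, h⟩ := hx
  refine ⟨c, |C|, hc, fun n a => ?_⟩
  obtain ⟨h1, h2⟩ := h n fun i => a i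
  rw [Fin.sum_univ_eq_sum_range fun i => a i • x i] at h1 h2
  refine ⟨fun l hl => le_trans ?_ h1, fun ha => h2.trans ?_⟩
  · exact mul_le_mul_of_nonneg_left (norm_le_pi_norm (fun i : Fin n => a i) ⟨l, hl⟩) hc.le
  · have h3 : ‖fun i : Fin n => a i‖ ≤ 1 :=
      (pi_norm_le_iff_of_nonneg zero_le_one).2 fun i => ha i
    calc C * ‖fun i : Fin n => a i‖ ≤ |C| * ‖fun i : Fin n => a i‖ :=
          mul_le_mul_of_nonneg_right (le_abs_self C) (norm_nonneg _)
      _ ≤ |C| := mul_le_of_le_one_right (abs_nonneg C) h3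

theorem IsEquivalentToCZeroBasis.isWUC {x : ℕ → X} (hx : IsEquivalentToCZeroBasis 𝕜 x) :
    IsWUC 𝕜 x := by
  obtain ⟨c, C, -, h⟩ := hx.exists_bounds
  exact IsWUC.of_forall_norm_sum_range_le fun n a => (h n a).2

theorem IsEquivalentToCZeroBasis.not_tendsto_zero {x : ℕ → X}
    (hx : IsEquivalentToCZeroBasis 𝕜 x) : ¬ Tendsto x atTop (𝓝 0) := by
  obtain ⟨c, C, hc, h⟩ := hx.exists_bounds
  intro h0
  have h1 : ∀ n, c ≤ ‖x n‖ := by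
    intro n
    have := (h (n + 1) (Pi.single n 1)).1 n (by omega)
    simpa [Finset.sum_range_succ, Finset.sum_eq_zero, Pi.single_apply, Finset.sum_ite_eq] using this
  have h2 := ge_of_tendsto' h0.norm h1
  rw [norm_zero] at h2
  linarith

end WUC

/-! ### The Bessaga–Pełczyński selection -/

section BessagaPelczynski

variable {𝕜 : Type} [RCLike 𝕜] {X : Type*} [NormedAddCommGroup X] [NormedSpace 𝕜 X]

theorem exists_tendsto_ultrafilter_of_norm_le {ι : Type*} (U : Ultrafilter ι)
    {φ : ι → StrongDual 𝕜 X} {r : ℝ} (hφ : ∀ i, ‖φ i‖ ≤ r) :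
    ∃ ψ : StrongDual 𝕜 X, ‖ψ‖ ≤ r ∧ ∀ x, Tendsto (fun i => φ i x) U (𝓝 (ψ x)) := by
  obtain ⟨ψ, hψ, hle⟩ := isCompact_iff_ultrafilter_le_nhds'.1
    (WeakDual.isCompact_closedBall (𝕜 := 𝕜) (E := X) 0 r)
    (U.map fun i => StrongDual.toWeakDual (φ i))
    (Filter.mem_map.2 (Filter.univ_mem' fun i => by simpa using hφ i))
  refine ⟨WeakDual.toStrongDual ψ, by simpa using hψ, fun x => ?_⟩
  exact ((WeakDual.eval_continuous x).tendsto ψ).comp hle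

/-- A w.u.C. sequence which is bounded away from zero has a subsequence equivalent to the unit
vector basis of `c₀`. -/
theorem IsWUC.exists_subseq_isEquivalentToCZeroBasis {y : ℕ → X} (hy : IsWUC 𝕜 y) {ε : ℝ}
    (hε : 0 < ε) (hyε : ∀ j, ε ≤ ‖y j‖) :
    ∃ f : ℕ → ℕ, StrictMono f ∧ IsEquivalentToCZeroBasis 𝕜 fun n => y (f n) := by
  choose φ hφ1 hφ2 using fun j => exists_dual_vector'' 𝕜 (y j)
  obtain ⟨ψ, hψ1, hψ⟩ := exists_tendsto_ultrafilter_of_norm_le (hyperfilter ℕ) hφ1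
  -- Subtracting the weak* limit makes the norming functionals tend to zero pointwise along the
  -- ultrafilter, while ψ is small on late terms, so the diagonal values stay large.
  set Φ : ℕ → StrongDual 𝕜 X := fun j => φ j - ψ with hΦ
  have hΦ2 : ∀ j, ‖Φ j‖ ≤ 2 := fun j => (norm_sub_le _ _).trans (by linarith [hφ1 j])
  have hΦ0 : ∀ x, Tendsto (fun j => ‖Φ j x‖) (hyperfilter ℕ) (𝓝 0) := by
    intro x
    have := ((hψ x).sub_const (ψ x)).norm
    simpa [hΦ] using this
  set η := ε / 8 with hη
  have hη0 : 0 < η := by positivity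
  -- The matrix $\Phi_{f(l)}(y_{f(i)})$ becomes diagonally dominant: the diagonal is at least 3ε/4,
  -- and row `l` contributes at most 2η to its left and η to its right, in all 3ε/8. Dividing by the
  -- norm bound 2 leaves 3ε/16, more than the required ε/8.
  obtain ⟨f, hfP, hfr⟩ := exists_seq_of_forall_finset_exists (fun j => ‖ψ (y j)‖ ≤ ε / 4)
    (fun j z => j < z ∧ ‖Φ z (y j)‖ ≤ η * (1 / 2) ^ j ∧ ∑' i, ‖Φ j (y (i + z))‖ ≤ η) (by
      intro s _
      refine Eventually.exists (f := (hyperfilter ℕ : Filter ℕ)) (Eventually.and ?_ ?_)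
      · refine Nat.hyperfilter_le_atTop ?_
        have := (hy ψ).tendsto_atTop_zero
        exact this.eventually (eventually_le_nhds (by positivity))
      · rw [Filter.eventually_all_finset]
        intro j _
        refine Eventually.and (Nat.hyperfilter_le_atTop (eventually_gt_atTop j))
          (Eventually.and ?_ (Nat.hyperfilter_le_atTop ?_))
        · exact (hΦ0 (y j)).eventually (eventually_le_nhds (by positivity))
        · exact (tendsto_sum_nat_add fun i => ‖Φ j (y i)‖).eventually (eventually_le_nhds hη0))
  have hmono : StrictMono f := fun m n hmn => (hfr m n hmn).1
  refine ⟨f, hmono, IsEquivalentToCZeroBasis.of_isWUC (hy.comp_injective hmono.injective)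
    (c := ε / 8) hη0 fun n a l hl hal => ?_⟩
  have hdiag : 3 / 4 * ε ≤ ‖Φ (f l) (y (f l))‖ := by
    have h1 : ‖φ (f l) (y (f l))‖ = ‖y (f l)‖ := by
      rw [hφ2, RCLike.norm_ofReal, abs_of_nonneg (norm_nonneg _)]
    have h2 := norm_sub_norm_le (φ (f l) (y (f l))) (ψ (y (f l)))
    simp only [hΦ, sub_apply]
    linarith [hyε (f l), hfP l]
  have hlow : ∑ i ∈ (Finset.range n).filter (· < l), ‖Φ (f l) (y (f i))‖ ≤ 2 * η := by
    calc ∑ i ∈ (Finset.range n).filter (· < l), ‖Φ (f l) (y (f i))‖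
        ≤ ∑ i ∈ (Finset.range n).filter (· < l), η * (1 / 2 : ℝ) ^ i := by
          refine Finset.sum_le_sum fun i hi => ?_
          refine (hfr i l (Finset.mem_filter.1 hi).2).2.1.trans ?_
          gcongr ?_ * ?_
          exact pow_le_pow_of_le_one (by norm_num) (by norm_num) hmono.le_apply
      _ ≤ ∑' i, η * (1 / 2 : ℝ) ^ i :=
          (summable_geometric_two.mul_left η).sum_le_tsum _ fun i _ => by positivity
      _ = 2 * η := by rw [tsum_mul_left, tsum_geometric_two, mul_comm]
  have hhigh : ∑ i ∈ (Finset.range n).filter (l < ·), ‖Φ (f l) (y (f i))‖ ≤ η := by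
    have hs : Summable fun i => ‖Φ (f l) (y (i + f (l + 1)))‖ :=
      (summable_nat_add_iff (f := fun i => ‖Φ (f l) (y i)‖) _).2 (hy _)
    have hle : ∀ i ∈ (Finset.range n).filter (l < ·), f (l + 1) ≤ f i := fun i hi =>
      hmono.monotone (Finset.mem_filter.1 hi).2
    have hinj : Set.InjOn (fun i => f i - f (l + 1)) ((Finset.range n).filter (l < ·)) := by
      intro i hi j hj hij
      have h1 := hle i hi
      have h2 := hle j hj
      exact hmono.injective (by simp only at hij; omega)
    calc ∑ i ∈ (Finset.range n).filter (l < ·), ‖Φ (f l) (y (f i))‖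
        = ∑ i ∈ ((Finset.range n).filter (l < ·)).image (fun i => f i - f (l + 1)),
            ‖Φ (f l) (y (i + f (l + 1)))‖ := by
          rw [Finset.sum_image hinj]
          refine Finset.sum_congr rfl fun i hi => ?_
          rw [Nat.sub_add_cancel (hle i hi)]
      _ ≤ ∑' i, ‖Φ (f l) (y (i + f (l + 1)))‖ := hs.sum_le_tsum _ fun _ _ => norm_nonneg _
      _ ≤ η := (hfr l (l + 1) (by omega)).2.2
  have hoff : ∑ i ∈ (Finset.range n).erase l, ‖Φ (f l) (y (f i))‖ ≤ 3 * η := by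
    have : (Finset.range n).erase l =
        (Finset.range n).filter (· < l) ∪ (Finset.range n).filter (l < ·) := by
      ext i
      simp only [Finset.mem_erase, Finset.mem_union, Finset.mem_filter]
      constructor
      · rintro ⟨h1, h2⟩
        rcases lt_or_gt_of_ne h1 with h | h
        · exact Or.inl ⟨h2, h⟩
        · exact Or.inr ⟨h2, h⟩
      · rintro (⟨h1, h2⟩ | ⟨h1, h2⟩)
        · exact ⟨h2.ne, h1⟩
        · exact ⟨h2.ne', h1⟩
    rw [this, Finset.sum_union]
    · linarith
    · rw [Finset.disjoint_left]
      intro i hi hi'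
      exact lt_asymm (Finset.mem_filter.1 hi).2 (Finset.mem_filter.1 hi').2
  have hval : 3 / 8 * ε * ‖a l‖ ≤ ‖Φ (f l) (∑ i ∈ Finset.range n, a i • y (f i))‖ := by
    rw [map_sum, ← Finset.add_sum_erase _ _ (Finset.mem_range.2 hl)]
    have h1 : ‖∑ i ∈ (Finset.range n).erase l, Φ (f l) (a i • y (f i))‖ ≤ 3 * η * ‖a l‖ := by
      refine (norm_sum_le _ _).trans ?_
      calc ∑ i ∈ (Finset.range n).erase l, ‖Φ (f l) (a i • y (f i))‖
          ≤ ∑ i ∈ (Finset.range n).erase l, ‖Φ (f l) (y (f i))‖ * ‖a l‖ := by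
            refine Finset.sum_le_sum fun i _ => ?_
            rw [map_smul, norm_smul, mul_comm]
            exact mul_le_mul_of_nonneg_left (hal i) (norm_nonneg _)
        _ ≤ 3 * η * ‖a l‖ := by
            rw [← Finset.sum_mul]
            exact mul_le_mul_of_nonneg_right hoff (norm_nonneg _)
    have h2 : 3 / 4 * ε * ‖a l‖ ≤ ‖Φ (f l) (a l • y (f l))‖ := by
      rw [map_smul, norm_smul, mul_comm ‖a l‖]
      exact mul_le_mul_of_nonneg_right hdiag (norm_nonneg _)
    have h3 := norm_sub_le_norm_add (Φ (f l) (a l • y (f l)))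
      (∑ i ∈ (Finset.range n).erase l, Φ (f l) (a i • y (f i)))
    have h4 : 3 * η * ‖a l‖ = 3 / 8 * ε * ‖a l‖ := by rw [hη]; ring
    linarith
  have hup := (Φ (f l)).le_of_opNorm_le (hΦ2 (f l)) (∑ i ∈ Finset.range n, a i • y (f i))
  have : 0 ≤ ε * ‖a l‖ := by positivity
  linarith

/-- Bessaga–Pełczyński: a w.u.C. series which is not unconditionally convergent has disjoint block
sums equivalent to the unit vector basis of `c₀`. -/
theorem IsWUC.exists_blocks [CompleteSpace X] {x : ℕ → X} (hx : IsWUC 𝕜 x)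
    (hns : ¬ Summable x) :
    ∃ B : ℕ → Finset ℕ, Pairwise (Function.onFun Disjoint B) ∧
      IsEquivalentToCZeroBasis 𝕜 fun m => ∑ i ∈ B m, x i := by
  classical
  rw [summable_iff_vanishing_norm] at hns
  push Not at hns
  obtain ⟨ε, hε, h⟩ := hns
  -- Failure of Cauchy's criterion gives a large block disjoint from any prescribed finite set, here
  -- the union of the earlier blocks.
  obtain ⟨B, hB, hdisj⟩ := exists_seq_of_forall_finset_exists'
    (fun t : Finset ℕ => ε ≤ ‖∑ i ∈ t, x i‖) Disjoint (fun s _ => by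
      obtain ⟨t, ht, ht'⟩ := h (s.biUnion id)
      refine ⟨t, ht', fun u hu => ?_⟩
      exact (ht.mono_right (Finset.subset_biUnion_of_mem id hu)).symm)
  obtain ⟨f, hf, hf'⟩ := (hx.blocks hdisj).exists_subseq_isEquivalentToCZeroBasis hε hB
  exact ⟨fun n => B (f n), fun i j hij => hdisj (hf.injective.ne hij), hf'⟩

end BessagaPelczynski

/-! ### Continuous homogeneous polynomials -/

section HomogeneousPolynomial

variable {𝕜 : Type} [RCLike 𝕜] {W X Y : Type*} [NormedAddCommGroup W] [NormedSpace 𝕜 W]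
  [NormedAddCommGroup X] [NormedSpace 𝕜 X] [NormedAddCommGroup Y] [NormedSpace 𝕜 Y]

theorem IsHomogeneousPolynomial.comp {k : ℕ} {P : X → Y} (hP : IsHomogeneousPolynomial 𝕜 k P)
    (T : W →L[𝕜] X) : IsHomogeneousPolynomial 𝕜 k (P ∘ T) := by
  obtain ⟨A, hA⟩ := hP
  exact ⟨A.compContinuousLinearMap fun _ => T, fun x => by simp [hA]⟩

theorem isHomogeneousPolynomial_one (T : W →L[𝕜] X) : IsHomogeneousPolynomial 𝕜 1 T :=
  ⟨T.compContinuousMultilinearMap (ContinuousMultilinearMap.ofSubsingleton 𝕜 W W (0 : Fin 1)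
    (ContinuousLinearMap.id 𝕜 W)), fun x => by simp⟩

theorem IsHomogeneousPolynomial.map_smul {k : ℕ} {P : X → Y}
    (hP : IsHomogeneousPolynomial 𝕜 k P) (c : 𝕜) (x : X) : P (c • x) = c ^ k • P x := by
  obtain ⟨A, hA⟩ := hP
  simpa [hA] using A.map_smul_univ (fun _ => c) fun _ => x

theorem IsHomogeneousPolynomial.exists_lipschitz {k : ℕ} {P : X → Y}
    (hP : IsHomogeneousPolynomial 𝕜 k P) (R : ℝ) :
    ∃ C, ∀ x y, ‖x‖ ≤ R → ‖y‖ ≤ R → ‖P x - P y‖ ≤ C * ‖x - y‖ := by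
  obtain ⟨A, hA⟩ := hP
  refine ⟨‖A‖ * k * R ^ (k - 1), fun x y hx hy => ?_⟩
  rw [hA, hA]
  refine (A.norm_image_sub_le _ _).trans ?_
  rw [Fintype.card_fin]
  have h : ∀ z : X, ‖fun _ : Fin k => z‖ ≤ ‖z‖ := fun z => pi_norm_const_le z
  have h1 : ‖(fun _ : Fin k => x) - fun _ => y‖ ≤ ‖x - y‖ := h (x - y)
  have h2 : max ‖fun _ : Fin k => x‖ ‖fun _ : Fin k => y‖ ≤ R :=
    max_le ((h x).trans hx) ((h y).trans hy)
  have hR : 0 ≤ R := (norm_nonneg x).trans hx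
  gcongr

theorem IsHomogeneousPolynomial.isBounded_image {k : ℕ} {P : X → Y}
    (hP : IsHomogeneousPolynomial 𝕜 k P) {s : Set X} (hs : Bornology.IsBounded s) :
    Bornology.IsBounded (P '' s) := by
  obtain ⟨R, hR0, hR⟩ := hs.exists_pos_norm_le
  obtain ⟨C, hC⟩ := hP.exists_lipschitz R
  refine isBounded_iff_forall_norm_le.2 ⟨|C| * R + ‖P 0‖, ?_⟩
  rintro _ ⟨x, hx, rfl⟩
  have h1 := hC x 0 (hR x hx) (by simpa using hR0.le)
  rw [sub_zero] at h1
  have h2 : C * ‖x‖ ≤ |C| * R := mul_le_mul (le_abs_self C) (hR x hx) (norm_nonneg _) (abs_nonneg C)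
  have h3 := norm_sub_norm_le (P x) (P 0)
  linarith

end HomogeneousPolynomial

/-! ### Compactness on bounded sequences -/

section CompactMaps

variable {𝕜 : Type} [RCLike 𝕜] {W X Y : Type*} [NormedAddCommGroup W] [NormedAddCommGroup X]
  [NormedAddCommGroup Y]

variable (𝕜) in
/-- `F` maps bounded sequences to sequences with relatively weakly compact range. -/
def MapsBoundedToRelWeaklyCompact [NormedSpace 𝕜 Y] (F : W → Y) : Prop :=
  ∀ w : ℕ → W, Bornology.IsBounded (Set.range w) → IsRelWeaklyCompact 𝕜 (Set.range fun n => F (w n))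

/-- `F` maps bounded sequences to sequences with relatively compact range. -/
def MapsBoundedToRelCompact (F : W → Y) : Prop :=
  ∀ w : ℕ → W, Bornology.IsBounded (Set.range w) → IsRelCompact (Set.range fun n => F (w n))

theorem MapsBoundedToRelCompact.weakly [NormedSpace 𝕜 Y] {F : W → Y} (hF : MapsBoundedToRelCompact F) :
    MapsBoundedToRelWeaklyCompact 𝕜 F :=
  fun w hw => (hF w hw).isRelWeaklyCompact

variable [NormedSpace 𝕜 W] [NormedSpace 𝕜 X]

theorem MapsBoundedToRelCompact.comp {F : X → Y} (hF : MapsBoundedToRelCompact F)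
    (T : W →L[𝕜] X) : MapsBoundedToRelCompact (F ∘ T) := by
  intro w hw
  refine hF (fun n => T (w n)) ?_
  have := T.lipschitz.isBounded_image hw
  rwa [← Set.range_comp] at this

/-- Points of the closure are replaced by points of `S` at distance below $1/(n+1)$, so subsequences
need only be extracted inside `S`. -/
theorem isRelCompact_of_forall_exists_tendsto {S : Set Y}
    (h : ∀ u : ℕ → Y, (∀ n, u n ∈ S) →
      ∃ (y : Y) (f : ℕ → ℕ), StrictMono f ∧ Tendsto (fun n => u (f n)) atTop (𝓝 y)) :
    IsRelCompact S := by
  refine IsSeqCompact.isCompact fun u hu => ?_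
  choose v hv hv' using fun n : ℕ =>
    Metric.mem_closure_iff.1 (hu n) (1 / ((n : ℝ) + 1)) (by positivity)
  obtain ⟨y, f, hf, hy⟩ := h v hv
  refine ⟨y, mem_closure_of_tendsto hy (Eventually.of_forall fun n => hv _), f, hf, ?_⟩
  refine hy.congr_dist ?_
  refine squeeze_zero (fun _ => dist_nonneg) (fun n => ?_)
    (tendsto_one_div_add_atTop_nhds_zero_nat.comp hf.tendsto_atTop)
  rw [dist_comm]
  exact (hv' (f n)).le

theorem MapsBoundedToRelCompact.isRelCompact_image {F : W → Y} (hF : MapsBoundedToRelCompact F)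
    {s : Set W} (hs : Bornology.IsBounded s) : IsRelCompact (F '' s) := by
  refine isRelCompact_of_forall_exists_tendsto fun u hu => ?_
  choose w hw hwu using hu
  have hb : Bornology.IsBounded (Set.range w) := hs.subset (Set.range_subset_iff.2 hw)
  obtain ⟨y, -, f, hf, hy⟩ := (hF w hb).isSeqCompact
    (fun n => subset_closure (Set.mem_range_self n))
  refine ⟨y, f, hf, hy.congr fun n => ?_⟩
  exact hwu (f n)

theorem MapsBoundedToRelCompact.isCompactPolynomial {F : W → Y}
    (hF : MapsBoundedToRelCompact F) : IsCompactPolynomial F :=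
  hF.isRelCompact_image Metric.isBounded_closedBall

theorem MapsBoundedToRelCompact.isCompactOperator {T : W →L[𝕜] X}
    (hT : MapsBoundedToRelCompact T) : IsCompactOperator T :=
  (isCompactOperator_iff_isCompact_closure_image_closedBall (T : W →ₗ[𝕜] X) one_pos).2
    hT.isCompactPolynomial

theorem mapsBoundedToRelCompact_of_isCompactOperator {T : W →L[𝕜] X}
    (hT : IsCompactOperator T) : MapsBoundedToRelCompact T := by
  intro w hw
  have h := IsCompactOperator.isCompact_closure_image_of_bounded (f := (T : W →ₗ[𝕜] X)) hT hw
  rwa [← Set.range_comp] at h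

theorem IsCompactPolynomial.mapsBoundedToRelCompact [NormedSpace 𝕜 Y] {k : ℕ} {F : W → Y}
    (hk : IsHomogeneousPolynomial 𝕜 k F) (hF : IsCompactPolynomial F) :
    MapsBoundedToRelCompact F := by
  intro w hw
  obtain ⟨R, hR0, hR⟩ := hw.exists_pos_norm_le
  have hc : IsCompact ((fun z => ((R : ℝ) : 𝕜) ^ k • z) '' closure (F '' Metric.closedBall 0 1)) :=
    IsCompact.image hF (continuous_const_smul _)
  refine hc.closure_of_subset ?_
  rintro _ ⟨n, rfl⟩
  have hR' : ((R : ℝ) : 𝕜) ≠ 0 := by exact_mod_cast hR0.ne'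
  refine ⟨F (((R : ℝ) : 𝕜)⁻¹ • w n), subset_closure ⟨_, ?_, rfl⟩, ?_⟩
  · rw [mem_closedBall_zero_iff, norm_smul, norm_inv, RCLike.norm_ofReal, abs_of_pos hR0,
      inv_mul_le_iff₀ hR0, mul_one]
    exact hR _ ⟨n, rfl⟩
  · simp only
    rw [← hk.map_smul, smul_inv_smul₀ hR']

/-- A homogeneous polynomial which is weakly compact on bounded sequences is unconditionally
converging. -/
theorem MapsBoundedToRelWeaklyCompact.isUnconditionallyConverging [NormedSpace 𝕜 Y]
    [CompleteSpace Y] {k : ℕ} {F : W → Y} (hk : IsHomogeneousPolynomial 𝕜 k F)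
    (hF : MapsBoundedToRelWeaklyCompact 𝕜 F) :
    IsUnconditionallyConverging 𝕜 F := by
  intro y hy
  have hbdd : ∀ h : W, Bornology.IsBounded (Set.range fun S : Finset ℕ => h + ∑ i ∈ S, y i) := by
    intro h
    obtain ⟨C, hC⟩ := isBounded_iff_forall_norm_le.1 hy.isBounded_range_sum
    refine isBounded_iff_forall_norm_le.2 ⟨‖h‖ + C, ?_⟩
    rintro _ ⟨S, rfl⟩
    exact (norm_add_le _ _).trans (add_le_add le_rfl (hC _ ⟨S, rfl⟩))
  have htail : TailCauchy F y := by
    refine hk.isPolyMap.tailCauchy_of_weak (𝕜 := 𝕜) (fun h => ?_) fun h U => ?_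
    · have := hk.isBounded_image (hbdd h)
      rwa [← Set.range_comp] at this
    -- The hypothesis concerns sequences, so the countably many finite sets are enumerated.
    · let e := (Denumerable.eqv (Finset ℕ)).symm
      have h1 := hF (fun n => h + ∑ i ∈ e n, y i)
        ((hbdd h).subset (Set.range_comp_subset_range e fun S => h + ∑ i ∈ S, y i))
      have h2 : (Set.range fun n => F (h + ∑ i ∈ e n, y i)) =
          Set.range fun S : Finset ℕ => F (h + ∑ i ∈ S, y i) :=
        e.surjective.range_comp fun S => F (h + ∑ i ∈ S, y i)
      rw [h2] at h1
      exact h1.exists_forall_tendsto U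
  refine cauchySeq_tendsto_of_complete (Metric.cauchySeq_iff.2 fun ε hε => ?_)
  obtain ⟨N, hN⟩ := htail Set.univ (ε / 2) (half_pos hε)
  refine ⟨N, fun m hm n hn => ?_⟩
  rw [dist_eq_norm]
  refine (hN _ _ (fun i hi => ?_) fun i hi => ?_).trans_lt (half_lt_self hε)
  · simpa using hi.trans_le hm
  · simpa using hi.trans_le hn

theorem IsUnconditionallyConverging.comp {F : X → Y} (hF : IsUnconditionallyConverging 𝕜 F)
    (T : W →L[𝕜] X) : IsUnconditionallyConverging 𝕜 (F ∘ T) := by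
  intro y hy
  simpa using hF _ (hy.map T)

end CompactMaps

/-! ### The gliding hump in $c_0$ -/

section CZero

variable {𝕜 : Type} [RCLike 𝕜]

/-- The restriction of a sequence of scalars to a finite set of indices, as an element of `c₀`. -/
def restrictCZero (s : Finset ℕ) (f : ℕ → 𝕜) : CZero 𝕜 where
  toFun i := if i ∈ s then f i else 0
  continuous_toFun := continuous_of_discreteTopology
  zero_at_infty' := by
    rw [Filter.cocompact_eq_cofinite]
    refine tendsto_const_nhds.congr' ?_
    filter_upwards [s.finite_toSet.compl_mem_cofinite] with i hi
    rw [if_neg]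
    simpa using hi

theorem restrictCZero_apply (s : Finset ℕ) (f : ℕ → 𝕜) (i : ℕ) :
    restrictCZero s f i = if i ∈ s then f i else 0 := rfl

theorem norm_apply_le_CZero (a : CZero 𝕜) (i : ℕ) : ‖a i‖ ≤ ‖a‖ :=
  (ZeroAtInftyContinuousMap.toBCF a).norm_coe_le_norm i

theorem norm_CZero_le {a : CZero 𝕜} {C : ℝ} (hC : 0 ≤ C) (h : ∀ i, ‖a i‖ ≤ C) : ‖a‖ ≤ C :=
  ((ZeroAtInftyContinuousMap.toBCF a).norm_le hC).2 h

theorem tendsto_CZero (a : CZero 𝕜) : Tendsto a atTop (𝓝 0) := by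
  have := a.zero_at_infty'
  rw [Filter.cocompact_eq_cofinite, Nat.cofinite_eq_atTop] at this
  exact this

variable (𝕜) in
/-- Evaluation at a coordinate. -/
noncomputable def evalCZero (i : ℕ) : CZero 𝕜 →L[𝕜] 𝕜 :=
  LinearMap.mkContinuous
    { toFun := fun a => a i
      map_add' := fun _ _ => rfl
      map_smul' := fun _ _ => rfl } 1 fun a => by simpa using norm_apply_le_CZero a i

@[simp]
theorem evalCZero_apply (i : ℕ) (a : CZero 𝕜) : evalCZero 𝕜 i a = a i := rfl

theorem isWUC_CZero_of_forall_sum_norm_apply_le {z : ℕ → CZero 𝕜} {C : ℝ} (hC : 0 ≤ C)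
    (h : ∀ i n, ∑ m ∈ Finset.range n, ‖z m i‖ ≤ C) : IsWUC 𝕜 z := by
  refine IsWUC.of_forall_norm_sum_range_le (M := C) fun n a ha => norm_CZero_le hC fun i => ?_
  rw [← evalCZero_apply, map_sum]
  refine (norm_sum_le _ _).trans ((Finset.sum_le_sum fun m _ => ?_).trans (h i n))
  rw [map_smul, norm_smul, evalCZero_apply]
  exact mul_le_of_le_one_left (norm_nonneg _) (ha m)

/-- From a bounded coordinatewise convergent sequence in `c₀` one can extract a subsequence which is
asymptotic to the partial sums of a w.u.C. series. -/
theorem exists_isWUC_tendsto_sub {v : ℕ → CZero 𝕜} {R : ℝ} (hv : ∀ n, ‖v n‖ ≤ R) {α : ℕ → 𝕜}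
    (hα : ∀ i, Tendsto (fun n => v n i) atTop (𝓝 (α i))) :
    ∃ (f : ℕ → ℕ) (z : ℕ → CZero 𝕜), StrictMono f ∧ IsWUC 𝕜 z ∧
      Tendsto (fun n => ‖v (f n) - ∑ m ∈ Finset.range (n + 1), z m‖) atTop (𝓝 0) := by
  have hR0 : 0 ≤ R := (norm_nonneg _).trans (hv 0)
  have hvi : ∀ n i, ‖v n i‖ ≤ R := fun n i => (norm_apply_le_CZero _ _).trans (hv n)
  have hαR : ∀ i, ‖α i‖ ≤ R := fun i => le_of_tendsto' (hα i).norm fun n => hvi n i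
  -- A pair holds an index into `v` and a cutoff: the chosen term is close to α below its own cutoff
  -- and small beyond every later one.
  obtain ⟨p, hpP, hpr⟩ := exists_seq_of_forall_finset_exists
    (fun p : ℕ × ℕ => ∀ i < p.2, ‖v p.1 i - α i‖ ≤ 1 / ((p.2 : ℝ) + 1))
    (fun p q => p.1 < q.1 ∧ p.2 < q.2 ∧ ∀ i ≥ q.2, ‖v p.1 i‖ ≤ 1 / ((p.2 : ℝ) + 1)) (by
      intro s _
      have h1 : ∀ᶠ N in atTop, ∀ p ∈ s, p.2 < N ∧ ∀ i ≥ N, ‖v p.1 i‖ ≤ 1 / ((p.2 : ℝ) + 1) := by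
        rw [Filter.eventually_all_finset]
        intro p _
        refine (eventually_gt_atTop _).and (Filter.eventually_forall_ge_atTop.2 ?_)
        have := (tendsto_CZero (v p.1)).norm
        rw [norm_zero] at this
        exact this.eventually (eventually_le_nhds (by positivity))
      obtain ⟨N, hN⟩ := h1.exists
      have h2 : ∀ᶠ n in atTop, (∀ p ∈ s, p.1 < n) ∧
          ∀ i ∈ Finset.range N, ‖v n i - α i‖ ≤ 1 / ((N : ℝ) + 1) := by
        refine Eventually.and ?_ ?_
        · rw [Filter.eventually_all_finset]
          exact fun p _ => eventually_gt_atTop _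
        · rw [Filter.eventually_all_finset]
          intro i _
          have := ((hα i).sub_const (α i)).norm
          rw [sub_self, norm_zero] at this
          exact this.eventually (eventually_le_nhds (by positivity))
      obtain ⟨n, hn, hn'⟩ := h2.exists
      exact ⟨(n, N), fun i hi => hn' i (Finset.mem_range.2 hi),
        fun p hp => ⟨hn p hp, (hN p hp).1, (hN p hp).2⟩⟩)
  set f : ℕ → ℕ := fun j => (p j).1 with hf
  set N : ℕ → ℕ := fun j => (p j).2 with hN
  have hfm : StrictMono f := fun i j hij => (hpr i j hij).1
  have hNm : StrictMono N := fun i j hij => (hpr i j hij).2.1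
  have hNs : ∀ j, N j < N (j + 1) := fun j => hNm (Nat.lt_succ_self j)
  -- `b j` replaces `v (f j)` by α below `N j` and by 0 from `N (j + 1)` on. Both changes are of
  -- size at most $1/(N_j+1)$.
  let b : ℕ → CZero 𝕜 := fun j =>
    restrictCZero (Finset.range (N (j + 1))) fun i => if i < N j then α i else v (f j) i
  have hb0 : ∀ j i, N (j + 1) ≤ i → b j i = 0 := fun j i h => by
    simp only [b, restrictCZero_apply, Finset.mem_range, if_neg (not_lt.2 h)]
  have hb1 : ∀ j i, N j ≤ i → i < N (j + 1) → b j i = v (f j) i := fun j i h h' => by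
    simp only [b, restrictCZero_apply, Finset.mem_range, if_pos h', if_neg (not_lt.2 h)]
  have hb2 : ∀ j i, i < N j → b j i = α i := fun j i h => by
    simp only [b, restrictCZero_apply, Finset.mem_range, if_pos (h.trans (hNs j)), if_pos h]
  let z : ℕ → CZero 𝕜 := fun j => b j - if j = 0 then 0 else b (j - 1)
  have hz0 : z 0 = b 0 := by simp [z]
  have hzs : ∀ j, z (j + 1) = b (j + 1) - b j := fun j => by simp [z]
  have hsum : ∀ n, ∑ m ∈ Finset.range (n + 1), z m = b n := by
    intro n
    rw [Finset.sum_range_succ']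
    simp only [hzs, hz0, Finset.sum_range_sub, sub_add_cancel]
  refine ⟨f, z, hfm, ?_, ?_⟩
  -- Along `b`, coordinate `i` starts at 0 until the cutoffs pass it, takes at most one value of
  -- `v`, then stays at `α i`. Its total variation is at most $R+2R$, whence the constant 3R.
  · have key : ∀ i n, (N (n + 1) ≤ i → ∑ m ∈ Finset.range (n + 1), ‖z m i‖ = 0) ∧
        (N n ≤ i → ∑ m ∈ Finset.range (n + 1), ‖z m i‖ ≤ R) ∧
        ∑ m ∈ Finset.range (n + 1), ‖z m i‖ ≤ 3 * R := by
      intro i n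
      induction n with
      | zero =>
        have h1 : ‖b 0 i‖ ≤ R := by
          rcases lt_or_ge i (N 0) with h | h
          · rw [hb2 0 i h]; exact hαR i
          · rcases lt_or_ge i (N 1) with h' | h'
            · rw [hb1 0 i h h']; exact hvi _ _
            · rw [hb0 0 i h', norm_zero]; exact hR0
        simp only [zero_add, Finset.sum_range_one, hz0]
        exact ⟨fun h => by rw [hb0 0 i h, norm_zero], fun _ => h1, by linarith⟩
      | succ n ih =>
        obtain ⟨ih0, ih1, ih2⟩ := ih
        rw [Finset.sum_range_succ, hzs, ZeroAtInftyContinuousMap.sub_apply]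
        rcases lt_or_ge i (N (n + 1)) with h | h
        · refine ⟨fun h' => absurd (h'.trans_lt h) (by simpa using (hNs (n + 1)).le),
            fun h' => absurd h (not_lt.2 h'), ?_⟩
          rw [hb2 (n + 1) i h]
          rcases lt_or_ge i (N n) with h' | h'
          · rw [hb2 n i h', sub_self, norm_zero, add_zero]
            exact ih2
          · rw [hb1 n i h' h]
            have := norm_sub_le (α i) (v (f n) i)
            linarith [ih1 h', hαR i, hvi (f n) i]
        · rw [ih0 h, hb0 n i h, sub_zero, zero_add]
          rcases lt_or_ge i (N (n + 1 + 1)) with h' | h'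
          · rw [hb1 (n + 1) i h h']
            exact ⟨fun h'' => absurd h' (not_lt.2 h''), fun _ => hvi _ _,
              (hvi _ _).trans (by linarith)⟩
          · rw [hb0 (n + 1) i h', norm_zero]
            exact ⟨fun _ => rfl, fun _ => hR0, by positivity⟩
    refine isWUC_CZero_of_forall_sum_norm_apply_le (C := 3 * R) (by positivity) fun i n => ?_
    exact (Finset.sum_le_sum_of_subset_of_nonneg (Finset.range_mono n.le_succ)
      fun _ _ _ => norm_nonneg _).trans (key i n).2.2
  · refine squeeze_zero (fun _ => norm_nonneg _) (fun n => ?_)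
      (tendsto_one_div_add_atTop_nhds_zero_nat.comp hNm.tendsto_atTop)
    rw [hsum]
    have hpos : 0 ≤ 1 / ((N n : ℝ) + 1) := by positivity
    refine norm_CZero_le hpos fun i => ?_
    rw [ZeroAtInftyContinuousMap.sub_apply]
    rcases lt_or_ge i (N n) with h | h
    · rw [hb2 n i h]
      exact hpP n i h
    · rcases lt_or_ge i (N (n + 1)) with h' | h'
      · rw [hb1 n i h h', sub_self, norm_zero]
        exact hpos
      · rw [hb0 n i h', sub_zero]
        exact (hpr n (n + 1) n.lt_succ_self).2.2 i h'

/-- An unconditionally converging homogeneous polynomial on `c₀` is compact. -/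
theorem IsUnconditionallyConverging.mapsBoundedToRelCompact {Y : Type*} [NormedAddCommGroup Y]
    [NormedSpace 𝕜 Y] {k : ℕ} {Q : CZero 𝕜 → Y} (hk : IsHomogeneousPolynomial 𝕜 k Q)
    (hQ : IsUnconditionallyConverging 𝕜 Q) : MapsBoundedToRelCompact Q := by
  intro w hw
  obtain ⟨R, hR0, hR⟩ := hw.exists_pos_norm_le
  refine isRelCompact_of_forall_exists_tendsto fun u hu => ?_
  choose m hm using hu
  have hcpt : IsCompact (Set.pi Set.univ fun _ : ℕ => Metric.closedBall (0 : 𝕜) R) :=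
    isCompact_univ_pi fun _ => isCompact_closedBall _ _
  -- Compactness of the product of discs gives coordinatewise convergence; the limit α is bounded
  -- but need not lie in $c_0$.
  obtain ⟨α, -, g, hg, hα⟩ := hcpt.tendsto_subseq (x := fun n i => w (m n) i) fun n i _ => by
    rw [mem_closedBall_zero_iff]
    exact (norm_apply_le_CZero _ _).trans (hR _ ⟨_, rfl⟩)
  rw [tendsto_pi_nhds] at hα
  obtain ⟨f, z, hf, hz, hzf⟩ := exists_isWUC_tendsto_sub (v := fun n => w (m (g n)))
    (fun n => hR _ ⟨_, rfl⟩) hα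
  obtain ⟨y, hy⟩ := hQ z hz
  refine ⟨y, g ∘ f, hg.comp hf, ?_⟩
  have hy' := (tendsto_add_atTop_iff_nat 1).2 hy
  obtain ⟨M, hM⟩ := isBounded_iff_forall_norm_le.1 hz.isBounded_range_sum
  obtain ⟨C, hC⟩ := hk.exists_lipschitz (max R M)
  refine hy'.congr_dist ?_
  refine squeeze_zero (fun _ => dist_nonneg) (fun n => ?_) (by simpa using hzf.const_mul C)
  rw [dist_comm, dist_eq_norm]
  simp only [Function.comp_apply, ← hm]
  exact hC _ _ ((hR _ ⟨_, rfl⟩).trans (le_max_left _ _)) ((hM _ ⟨_, rfl⟩).trans (le_max_right _ _))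

end CZero

/-! ### Operators on $c_0$ and w.u.C. series -/

section Synthesis

variable {𝕜 : Type} [RCLike 𝕜] {X Z : Type*} [NormedAddCommGroup X] [NormedSpace 𝕜 X]
  [NormedAddCommGroup Z] [NormedSpace 𝕜 Z]

theorem IsWUC.summable_smul [CompleteSpace X] {x : ℕ → X} (hx : IsWUC 𝕜 x) (a : CZero 𝕜) :
    Summable fun i => a i • x i := by
  obtain ⟨M, hM0, hM⟩ := hx.exists_forall_norm_sum_le
  rw [summable_iff_vanishing_norm]
  intro ε hε
  have h0 := (tendsto_CZero a).norm
  rw [norm_zero] at h0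
  have hδ : 0 < ε / (M + 1) := by positivity
  obtain ⟨N, hN⟩ := eventually_atTop.1 (h0.eventually (eventually_le_nhds hδ))
  refine ⟨Finset.range N, fun t ht => ?_⟩
  refine (hM t a (ε / (M + 1)) hδ.le fun i hi => hN i ?_).trans_lt ?_
  · by_contra h
    exact Finset.disjoint_left.1 ht hi (Finset.mem_range.2 (not_le.1 h))
  · rw [mul_div_assoc', div_lt_iff₀ (by positivity)]
    nlinarith

/-- The operator `c₀ → X`, `a ↦ ∑ aᵢ xᵢ`, defined by a w.u.C. series `∑ xᵢ`. -/
noncomputable def synthesis [CompleteSpace X] (x : ℕ → X) (hx : IsWUC 𝕜 x) : CZero 𝕜 →L[𝕜] X :=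
  LinearMap.mkContinuousOfExistsBound
    { toFun := fun a => ∑' i, a i • x i
      map_add' := fun a b => by
        simp only [ZeroAtInftyContinuousMap.add_apply, add_smul]
        exact (hx.summable_smul a).tsum_add (hx.summable_smul b)
      map_smul' := fun c a => by
        simp only [ZeroAtInftyContinuousMap.smul_apply, smul_assoc, RingHom.id_apply]
        exact (hx.summable_smul a).tsum_const_smul c } (by
    obtain ⟨M, hM0, hM⟩ := hx.exists_forall_norm_sum_le
    refine ⟨M, fun a => ?_⟩
    exact le_of_tendsto (hx.summable_smul a).hasSum.norm (Eventually.of_forall fun S =>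
      hM S a _ (norm_nonneg _) fun i _ => norm_apply_le_CZero a i))

theorem synthesis_apply [CompleteSpace X] {x : ℕ → X} (hx : IsWUC 𝕜 x) (a : CZero 𝕜) :
    synthesis x hx a = ∑' i, a i • x i := rfl

theorem map_synthesis [CompleteSpace X] [CompleteSpace Z] {x : ℕ → X} (hx : IsWUC 𝕜 x)
    (T : X →L[𝕜] Z) (a : CZero 𝕜) :
    T (synthesis x hx a) = synthesis (fun i => T (x i)) (hx.map T) a := by
  rw [synthesis_apply, synthesis_apply, T.map_tsum (hx.summable_smul a)]
  simp

variable (𝕜) in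
/-- Characteristic functions of disjoint finite sets form a w.u.C. series in `c₀`. -/
theorem isWUC_restrictCZero {B : ℕ → Finset ℕ} (hB : Pairwise (Function.onFun Disjoint B)) :
    IsWUC 𝕜 fun m => restrictCZero (B m) (fun _ => (1 : 𝕜)) := by
  refine isWUC_CZero_of_forall_sum_norm_apply_le zero_le_one fun i n => ?_
  have h : ∀ m, ‖restrictCZero (B m) (fun _ => (1 : 𝕜)) i‖ = if i ∈ B m then 1 else 0 := by
    intro m
    rw [restrictCZero_apply]
    split_ifs <;> simp
  simp only [h, Finset.sum_boole]
  norm_cast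
  refine Finset.card_le_one.2 fun l hl m hm => ?_
  by_contra hlm
  exact Finset.disjoint_left.1 (hB hlm) (Finset.mem_filter.1 hl).2 (Finset.mem_filter.1 hm).2

theorem synthesis_restrictCZero [CompleteSpace X] {x : ℕ → X} (hx : IsWUC 𝕜 x) (s : Finset ℕ) :
    synthesis x hx (restrictCZero s fun _ => (1 : 𝕜)) = ∑ i ∈ s, x i := by
  rw [synthesis_apply, tsum_eq_sum (s := s) fun i hi => by rw [restrictCZero_apply, if_neg hi,
    zero_smul]]
  exact Finset.sum_congr rfl fun i hi => by rw [restrictCZero_apply, if_pos hi, one_smul]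

/-- The operator defined by block sums factors through the operator defined by the series. -/
theorem synthesis_blocks [CompleteSpace X] {x : ℕ → X} (hx : IsWUC 𝕜 x) {B : ℕ → Finset ℕ}
    (hB : Pairwise (Function.onFun Disjoint B)) :
    synthesis _ (hx.blocks hB) = (synthesis x hx).comp (synthesis _ (isWUC_restrictCZero 𝕜 hB)) := by
  ext a
  rw [ContinuousLinearMap.comp_apply, map_synthesis]
  simp only [synthesis_restrictCZero]

theorem pairwise_disjoint_singleton_nat :
    Pairwise (Function.onFun Disjoint fun n : ℕ => ({n} : Finset ℕ)) := by
  intro i j hij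
  simpa [Function.onFun] using hij

variable (𝕜) in
/-- The unit vector basis of `c₀`. -/
def basisCZero (n : ℕ) : CZero 𝕜 := restrictCZero {n} fun _ => 1

variable (𝕜) in
theorem isWUC_basisCZero : IsWUC 𝕜 (basisCZero 𝕜) :=
  isWUC_restrictCZero 𝕜 pairwise_disjoint_singleton_nat

theorem sum_smul_basisCZero_apply (s : Finset ℕ) (a : ℕ → 𝕜) (j : ℕ) :
    (∑ i ∈ s, a i • basisCZero 𝕜 i) j = if j ∈ s then a j else 0 := by
  rw [← evalCZero_apply, map_sum]
  simp [basisCZero, restrictCZero_apply]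

theorem synthesis_basisCZero (a : CZero 𝕜) : synthesis _ (isWUC_basisCZero 𝕜) a = a := by
  ext j
  rw [← evalCZero_apply, synthesis_apply,
    (evalCZero 𝕜 j).map_tsum ((isWUC_basisCZero 𝕜).summable_smul a)]
  rw [tsum_eq_single j]
  · simp [basisCZero, restrictCZero_apply]
  · intro i hi
    simp [basisCZero, restrictCZero_apply, hi.symm]

/-- Every operator on $c_0$ arises from a w.u.C. series, so statements about operators and about
series are interchangeable. -/
theorem synthesis_map_basisCZero [CompleteSpace X] (T : CZero 𝕜 →L[𝕜] X) :
    synthesis _ ((isWUC_basisCZero 𝕜).map T) = T := by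
  ext a
  rw [← map_synthesis (isWUC_basisCZero 𝕜), synthesis_basisCZero]

theorem isEquivalentToCZeroBasis_map_basisCZero (T : CZero 𝕜 →L[𝕜] X) {c : ℝ} (hc : 0 < c)
    (hT : ∀ a, c * ‖a‖ ≤ ‖T a‖) : IsEquivalentToCZeroBasis 𝕜 fun n => T (basisCZero 𝕜 n) := by
  refine IsEquivalentToCZeroBasis.of_isWUC ((isWUC_basisCZero 𝕜).map T) hc fun n a l hl _ => ?_
  have h1 := hT (∑ i ∈ Finset.range n, a i • basisCZero 𝕜 i)
  have h2 := norm_apply_le_CZero (∑ i ∈ Finset.range n, a i • basisCZero 𝕜 i) l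
  rw [sum_smul_basisCZero_apply, if_pos (Finset.mem_range.2 hl)] at h2
  simp only [map_sum, map_smul] at h1
  exact (mul_le_mul_of_nonneg_left h2 hc.le).trans h1

theorem IsEquivalentToCZeroBasis.exists_le_norm_synthesis [CompleteSpace X] {x : ℕ → X}
    (hx : IsEquivalentToCZeroBasis 𝕜 x) :
    ∃ c : ℝ, 0 < c ∧ ∀ a, c * ‖a‖ ≤ ‖synthesis x hx.isWUC a‖ := by
  obtain ⟨c, C, hc, h⟩ := hx.exists_bounds
  refine ⟨c, hc, fun a => ?_⟩
  rw [← le_div_iff₀' hc]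
  refine norm_CZero_le (by positivity) fun l => ?_
  rw [le_div_iff₀' hc]
  refine ge_of_tendsto (hx.isWUC.summable_smul a).hasSum.tendsto_sum_nat.norm ?_
  filter_upwards [eventually_gt_atTop l] with n hn
  exact (h n a).1 l hn

theorem IsEquivalentToCZeroBasis.not_isUC {x : ℕ → X} (hx : IsEquivalentToCZeroBasis 𝕜 x) :
    ¬ IsUC x :=
  fun h => hx.not_tendsto_zero h.tendsto_zero

end Synthesis

/-! ### Copies of $c_0$ on which the polynomial is compact -/

section Main

variable {𝕜 : Type} [RCLike 𝕜] {X Y Z : Type*} [NormedAddCommGroup X] [NormedSpace 𝕜 X]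
  [CompleteSpace X] [NormedAddCommGroup Y] [NormedAddCommGroup Z] [NormedSpace 𝕜 Z]

variable (𝕜) in
/-- There is a sequence equivalent to the unit vector basis of `c₀` on which `P` is compact. -/
def IsCompactOnCZero (P : X → Y) : Prop :=
  ∃ (x : ℕ → X) (hx : IsEquivalentToCZeroBasis 𝕜 x), MapsBoundedToRelCompact
    (P ∘ synthesis x hx.isWUC)

theorem IsEquivalentToCZeroBasis.not_isUnconditionallyConverging {x : ℕ → X}
    (hx : IsEquivalentToCZeroBasis 𝕜 x) :
    ¬ IsUnconditionallyConverging 𝕜 (synthesis x hx.isWUC) := by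
  intro h
  obtain ⟨s, hs⟩ := h _ (isWUC_basisCZero 𝕜)
  have h1 : ∀ i, synthesis x hx.isWUC (basisCZero 𝕜 i) = x i := fun i => by
    rw [basisCZero, synthesis_restrictCZero, Finset.sum_singleton]
  simp only [map_sum, h1] at hs
  refine hx.not_tendsto_zero ?_
  have := ((tendsto_add_atTop_iff_nat 1).2 hs).sub hs
  simpa [Finset.sum_range_succ] using this

/-- A series witnessing the failure for `T` has image blocks equivalent to the $c_0$-basis. Their
operator lifts through `T` to the blocks in $Z$, where `P ∘ T` is unconditionally converging, hence
compact on $c_0$. -/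
theorem IsCompactOnCZero.of_isUnconditionallyConverging_comp [NormedSpace 𝕜 Y] [CompleteSpace Z] {k : ℕ}
    {P : X → Y} (hP : IsHomogeneousPolynomial 𝕜 k P) (T : Z →L[𝕜] X)
    (hPT : IsUnconditionallyConverging 𝕜 (P ∘ T)) (hT : ¬ IsUnconditionallyConverging 𝕜 T) :
    IsCompactOnCZero 𝕜 P := by
  rw [IsUnconditionallyConverging] at hT
  push Not at hT
  obtain ⟨z, hz, hzT⟩ := hT
  have hns : ¬ Summable fun i => T (z i) := by
    intro hs
    refine hzT (∑' i, T (z i)) ?_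
    simpa only [map_sum] using hs.hasSum.tendsto_sum_nat
  obtain ⟨B, hB, hBx⟩ := (hz.map T).exists_blocks hns
  refine ⟨_, hBx, IsUnconditionallyConverging.mapsBoundedToRelCompact (hP.comp _) ?_⟩
  have h1 : synthesis _ hBx.isWUC = T.comp (synthesis _ (hz.blocks hB)) := by
    ext a
    rw [ContinuousLinearMap.comp_apply, map_synthesis]
    simp only [map_sum]
  rw [h1]
  exact hPT.comp (synthesis _ (hz.blocks hB))

/-- The synthesis operator is bounded below, so its range is a closed copy of $c_0$. -/
theorem IsCompactOnCZero.exists_submodule {P : X → Y} (h : IsCompactOnCZero 𝕜 P) :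
    ∃ M : Submodule 𝕜 X, IsClosed (M : Set X) ∧ IsIsomorphicToCZero 𝕜 M ∧
      IsCompactPolynomial (P ∘ M.subtypeL) := by
  obtain ⟨x, hx, hc⟩ := h
  obtain ⟨c, hc0, hlow⟩ := hx.exists_le_norm_synthesis
  set T := synthesis x hx.isWUC
  have hanti : AntilipschitzWith (Real.toNNReal c⁻¹) T := by
    refine AddMonoidHomClass.antilipschitz_of_bound T fun a => ?_
    rw [Real.coe_toNNReal _ (by positivity), ← div_eq_inv_mul, le_div_iff₀' hc0]
    exact hlow a
  have hclosed : IsClosed (Set.range T) := hanti.isClosed_range T.uniformContinuous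
  let e : CZero 𝕜 ≃L[𝕜] T.range := T.equivRange hanti.injective hclosed
  refine ⟨T.range, hclosed, ⟨e.symm⟩, ?_⟩
  have h1 : P ∘ T.range.subtypeL = (P ∘ T) ∘ (e.symm : T.range →L[𝕜] CZero 𝕜) := by
    funext m
    have h2 : T (e.symm m) = (e (e.symm m) : X) := rfl
    rw [e.apply_symm_apply] at h2
    exact congrArg P h2.symm
  rw [h1]
  exact (hc.comp _).isCompactPolynomial

theorem IsCompactOnCZero.of_containsCZero [NormedSpace 𝕜 Y] {k : ℕ} {P : X → Y}
    (hP : IsHomogeneousPolynomial 𝕜 k P) {M : Submodule 𝕜 X} (hM : ContainsCZero 𝕜 M)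
    (h : IsUnconditionallyConverging 𝕜 (P ∘ M.subtypeL)) : IsCompactOnCZero 𝕜 P := by
  obtain ⟨N, ⟨e⟩⟩ := hM
  let T₀ : CZero 𝕜 →L[𝕜] M := N.subtypeL.comp (e.symm : CZero 𝕜 →L[𝕜] N)
  let T : CZero 𝕜 →L[𝕜] X := M.subtypeL.comp T₀
  have hnorm : ∀ a, ‖T a‖ = ‖e.symm a‖ := fun a => rfl
  have hlow : ∀ a, (‖(e : N →L[𝕜] CZero 𝕜)‖ + 1)⁻¹ * ‖a‖ ≤ ‖T a‖ := by
    intro a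
    rw [inv_mul_le_iff₀ (by positivity), hnorm]
    have := (e : N →L[𝕜] CZero 𝕜).le_opNorm (e.symm a)
    simp only [ContinuousLinearEquiv.coe_coe, ContinuousLinearEquiv.apply_symm_apply] at this
    linarith [norm_nonneg (e.symm a)]
  refine ⟨_, isEquivalentToCZeroBasis_map_basisCZero T (by positivity) hlow, ?_⟩
  rw [synthesis_map_basisCZero]
  exact IsUnconditionallyConverging.mapsBoundedToRelCompact (hP.comp T) (h.comp T₀)

theorem containsCZero_of_isIsomorphicToCZero (h : IsIsomorphicToCZero 𝕜 Z) :
    ContainsCZero 𝕜 Z := by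
  obtain ⟨e⟩ := h
  exact ⟨⊤, ⟨Submodule.topContEquiv.trans e⟩⟩

end Main

/-- If unconditional convergence of `P ∘ T` implies that of `T` for all operators `T` on Banach
spaces in some universe, then also for the operators on spaces in the lowest universe. -/
theorem isUnconditionallyConverging_of_forall_universe {𝕜 : Type} [RCLike 𝕜]
    {X Y : Type*} [NormedAddCommGroup X] [NormedSpace 𝕜 X] [NormedAddCommGroup Y] {P : X → Y}
    (h : ∀ (Z : Type w) [NormedAddCommGroup Z] [NormedSpace 𝕜 Z] [CompleteSpace Z] (T : Z →L[𝕜] X),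
      IsUnconditionallyConverging 𝕜 (P ∘ T) → IsUnconditionallyConverging 𝕜 T)
    {E : Type} [NormedAddCommGroup E] [NormedSpace 𝕜 E] [CompleteSpace E] (T : E →L[𝕜] X)
    (hT : IsUnconditionallyConverging 𝕜 (P ∘ T)) : IsUnconditionallyConverging 𝕜 T := by
  let e : ULift.{w} E ≃L[𝕜] E := ContinuousLinearEquiv.ulift
  have h1 := h (ULift.{w} E) (T.comp (e : ULift.{w} E →L[𝕜] E))
    (hT.comp (e : ULift.{w} E →L[𝕜] E))
  exact h1.comp (e.symm : E →L[𝕜] ULift.{w} E)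

/-! ### Series criteria -/

section Characterizations

variable {𝕜 : Type} [RCLike 𝕜] {X Y : Type*} [NormedAddCommGroup X] [NormedSpace 𝕜 X]
  [CompleteSpace X] [NormedAddCommGroup Y]

theorem not_isCompactOnCZero_iff {P : X → Y} :
    ¬ IsCompactOnCZero 𝕜 P ↔ ∀ x : ℕ → X, IsEquivalentToCZeroBasis 𝕜 x →
      ∃ a : ℕ → CZero 𝕜, Bornology.IsBounded (Set.range a) ∧ ¬ IsRelCompact (imageSet P x a) := by
  simp only [IsCompactOnCZero, not_exists, MapsBoundedToRelCompact, not_forall, exists_prop]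
  rfl

theorem isUC_of_not_isCompactOnCZero {P : X → Y} (hP : ¬ IsCompactOnCZero 𝕜 P) {x : ℕ → X}
    (hx : IsWUC 𝕜 x) (h : MapsBoundedToRelCompact (P ∘ synthesis x hx)) : IsUC x := by
  by_contra hUC
  obtain ⟨B, hB, hBx⟩ := hx.exists_blocks (mt isUC_of_summable hUC)
  refine hP ⟨_, hBx, ?_⟩
  rw [synthesis_blocks hx hB]
  exact h.comp (synthesis _ (isWUC_restrictCZero 𝕜 hB))

theorem isUC_of_not_isCompactOnCZero_of_weakly [NormedSpace 𝕜 Y] [CompleteSpace Y] {k : ℕ}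
    {P : X → Y} (hk : IsHomogeneousPolynomial 𝕜 k P) (hP : ¬ IsCompactOnCZero 𝕜 P) {x : ℕ → X}
    (hx : IsWUC 𝕜 x) (h : MapsBoundedToRelWeaklyCompact 𝕜 (P ∘ synthesis x hx)) : IsUC x :=
  isUC_of_not_isCompactOnCZero hP hx
    ((h.isUnconditionallyConverging (hk.comp _)).mapsBoundedToRelCompact (hk.comp _))

end Characterizations

end OrliczPettis

theorem theorem2p1 {𝕜 : Type} [RCLike 𝕜]
    {X : Type u} [NormedAddCommGroup X] [NormedSpace 𝕜 X] [CompleteSpace X]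
    {Y : Type v} [NormedAddCommGroup Y] [NormedSpace 𝕜 Y] [CompleteSpace Y]
    (k : ℕ) (hk : 1 ≤ k) (P : X → Y) (hP : IsHomogeneousPolynomial 𝕜 k P) :
    List.TFAE [
      -- (A)
      ∀ x : ℕ → X, IsWUC 𝕜 x →
        (∀ a : ℕ → CZero 𝕜, Bornology.IsBounded (Set.range a) →
          IsRelWeaklyCompact 𝕜 (imageSet P x a)) →
        IsUC x,
      -- (B)
      ∀ x : ℕ → X, IsWUC 𝕜 x →
        (∀ a : ℕ → CZero 𝕜, Bornology.IsBounded (Set.range a) →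
          IsRelCompact (imageSet P x a)) →
        IsUC x,
      -- (C)
      ∀ x : ℕ → X, IsEquivalentToCZeroBasis 𝕜 x →
        ∃ a : ℕ → CZero 𝕜, Bornology.IsBounded (Set.range a) ∧
          ¬ IsRelWeaklyCompact 𝕜 (imageSet P x a),
      -- (D)
      ∀ x : ℕ → X, IsEquivalentToCZeroBasis 𝕜 x →
        ∃ a : ℕ → CZero 𝕜, Bornology.IsBounded (Set.range a) ∧
          ¬ IsRelCompact (imageSet P x a),
      -- (E)
      ∀ (Z : Type w) [NormedAddCommGroup Z] [NormedSpace 𝕜 Z] [CompleteSpace Z] (T : Z →L[𝕜] X),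
        IsUnconditionallyConverging 𝕜 (P ∘ T) → IsUnconditionallyConverging 𝕜 T,
      -- (F)
      ∀ T : CZero 𝕜 →L[𝕜] X, IsCompactPolynomial (P ∘ T) → IsCompactOperator T,
      -- (G)
      ∀ M : Submodule 𝕜 X, IsClosed (M : Set X) → ContainsCZero 𝕜 M →
        ¬ IsUnconditionallyConverging 𝕜 (P ∘ M.subtypeL),
      -- (H)
      ∀ M : Submodule 𝕜 X, IsClosed (M : Set X) → IsIsomorphicToCZero 𝕜 M →
        ¬ IsCompactPolynomial (P ∘ M.subtypeL)] := by
  -- Assertion (D) becomes the negation of `IsCompactOnCZero`, through which the other assertions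
  -- are linked.
  rw [← not_isCompactOnCZero_iff]
  tfae_have 1 → 3 := by
    intro hA x hx
    by_contra! h
    exact hx.not_isUC (hA x hx.isWUC h)
  tfae_have 3 → 4 := by
    rintro hC ⟨x, hx, h⟩
    obtain ⟨a, ha, hna⟩ := hC x hx
    exact hna (h a ha).isRelWeaklyCompact
  tfae_have 4 → 1 := by
    intro hD x hx h
    exact isUC_of_not_isCompactOnCZero_of_weakly hP hD hx h
  tfae_have 4 → 2 := by
    intro hD x hx h
    exact isUC_of_not_isCompactOnCZero hD hx h
  tfae_have 2 → 4 := by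
    rintro hB ⟨x, hx, h⟩
    exact hx.not_isUC (hB x hx.isWUC h)
  tfae_have 4 → 5 := by
    intro hD Z _ _ _ T hPT
    by_contra hT
    exact hD (IsCompactOnCZero.of_isUnconditionallyConverging_comp hP T hPT hT)
  tfae_have 5 → 4 := by
    rintro hE ⟨x, hx, h⟩
    refine hx.not_isUnconditionallyConverging
      (isUnconditionallyConverging_of_forall_universe.{w} hE _ ?_)
    exact h.weakly.isUnconditionallyConverging (hP.comp _)
  tfae_have 4 → 6 := by
    intro hD T hPT
    by_contra hT
    have h1 := (IsCompactPolynomial.mapsBoundedToRelCompact (hP.comp T) hPT).weakly (𝕜 := 𝕜)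
    refine hD (IsCompactOnCZero.of_isUnconditionallyConverging_comp hP T
      (h1.isUnconditionallyConverging (hP.comp T)) fun hT' => hT ?_)
    exact (hT'.mapsBoundedToRelCompact (isHomogeneousPolynomial_one T)).isCompactOperator
  tfae_have 6 → 4 := by
    rintro hF ⟨x, hx, h⟩
    -- Were the synthesis operator compact, it would be unconditionally converging, yet it carries
    -- the unit vectors to `x`, which does not tend to zero.
    have h1 := mapsBoundedToRelCompact_of_isCompactOperator (hF _ h.isCompactPolynomial)
    exact hx.not_isUnconditionallyConverging
      (h1.weakly.isUnconditionallyConverging (isHomogeneousPolynomial_one _))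
  tfae_have 4 → 7 := by
    intro hD M _ hM h
    exact hD (IsCompactOnCZero.of_containsCZero hP hM h)
  tfae_have 7 → 8 := by
    intro hG M hM hMc h
    refine hG M hM (containsCZero_of_isIsomorphicToCZero hMc) ?_
    have h1 := (IsCompactPolynomial.mapsBoundedToRelCompact (hP.comp M.subtypeL) h).weakly (𝕜 := 𝕜)
    exact h1.isUnconditionallyConverging (hP.comp M.subtypeL)
  tfae_have 8 → 4 := by
    intro hH hc
    obtain ⟨M, hM, hMc, h⟩ := hc.exists_submodule
    exact hH M hM hMc h
  tfae_finish
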